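/- An \emph{edge-to-edge gluing of unit squares} consists of finitely many unit squares together with a pairing of all their edges (each edge is paired with exactly one other edge, possibly of the same square) and, for each pair, one of the two isometries between its two edges, along which these edges are identified. The resulting closed surface carries the intrinsic metric induced by the Euclidean metric of the squares; the \emph{vertices} of the gluing are the points of the surface that come from corners of the squares. A \emph{shortest path} is a path in the surface whose length is minimal among all paths with the same endpoints. \textbf{Theorem.} Let $T$ be a (closed) square of an edge-to-edge gluing of unit squares and let $\pi$ be a geodesic shortest path between two vertices of the gluing. Then the intersection of $\pi$ and $T$, viewed as the set of points of the unit square $T$ whose images in the surface lie on $\pi$, is a union of at most $5$ straight line segments (a segment may consist of a single point). -/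

import Mathlib

open scoped ENNReal

/-- The Euclidean plane. -/
abbrev Plane : Type := EuclideanSpace ℝ (Fin 2)

/-- The closed unit square, with the Euclidean metric of the plane. -/
abbrev UnitSquare : Type := {p : Plane // ∀ i, p i ∈ Set.Icc (0 : ℝ) 1}

/-- The corners of the unit square, in counterclockwise order. -/
noncomputable def corner : Fin 4 → Plane :=
  ![!₂[0, 0], !₂[1, 0], !₂[1, 1], !₂[0, 1]]

/-- The `k`-th side of the unit square, from `corner k` (at `t = 0`) to `corner (k + 1)`
(at `t = 1`); the index is read modulo `4`. -/
noncomputable def sidePoint (k : Fin 4) (t : ℝ) : Plane :=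
  AffineMap.lineMap (corner k) (corner (k + 1)) t

/-- An edge-to-edge gluing of unit squares indexed by `ι`. An edge is a pair `(i, k)`: side `k`
of square `i`. Every edge is glued, along its whole length, to one other edge (possibly of the same
square), by one of the two isometries between them: `t ↦ t` or `t ↦ 1 - t` in the parametrization
`sidePoint`. -/
structure SquareGluing (ι : Type*) where
  /-- the edge to which an edge is glued -/
  mate : ι × Fin 4 → ι × Fin 4
  mate_mate : ∀ e, mate (mate e) = e
  mate_ne : ∀ e, mate e ≠ e
  /-- whether the edge is glued by `t ↦ 1 - t` (otherwise by `t ↦ t`) -/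
  reversed : ι × Fin 4 → Bool
  reversed_mate : ∀ e, reversed (mate e) = reversed e

namespace SquareGluing

variable {ι : Type*} (G : SquareGluing ι)

/-- Two boundary points of the squares that the gluing of some edge puts on top of each other. -/
def Glued (x y : ι × UnitSquare) : Prop :=
  ∃ (e : ι × Fin 4) (t : ℝ), t ∈ Set.Icc (0 : ℝ) 1 ∧
    x.1 = e.1 ∧ (x.2 : Plane) = sidePoint e.2 t ∧
    y.1 = (G.mate e).1 ∧
    (y.2 : Plane) = sidePoint (G.mate e).2 (if G.reversed e then 1 - t else t)

/-- The glued surface: the disjoint union of the squares modulo the equivalence relation generated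
by `Glued`. -/
def Surface : Type _ := Quot G.Glued

/-- The point of the surface given by the point `p` of square `i`. -/
def pt (i : ι) (p : UnitSquare) : G.Surface := Quot.mk _ (i, p)

/-- `G.JoinedBy u v ℓ`: the points `u` and `v` of the surface are joined by a polygonal path of
length `ℓ`, that is, by a chain of finitely many straight segments, each of them in one square. -/
inductive JoinedBy : G.Surface → G.Surface → ℝ≥0∞ → Prop
  | seg (i : ι) (p q : UnitSquare) : JoinedBy (G.pt i p) (G.pt i q) (edist p q)
  | trans {u v w : G.Surface} {a b : ℝ≥0∞} :
      JoinedBy u v a → JoinedBy v w b → JoinedBy u w (a + b)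

theorem JoinedBy.symm {u v : G.Surface} {a : ℝ≥0∞} (h : G.JoinedBy u v a) :
    G.JoinedBy v u a := by
  induction h with
  | seg i p q => rw [edist_comm]; exact .seg i q p
  | trans _ _ h₁ h₂ => rw [add_comm]; exact .trans h₂ h₁

/-- The intrinsic metric of the surface: the infimum of the lengths of the polygonal paths joining
two points (`⊤` if they lie in different components). The topology is the one of this metric; for
finitely many squares it is the quotient topology. -/
noncomputable instance : PseudoEMetricSpace G.Surface where
  edist u v := sInf {a | G.JoinedBy u v a}
  edist_self u := by
    obtain ⟨⟨i, p⟩, rfl⟩ := Quot.exists_rep u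
    refine le_antisymm (sInf_le ?_) (zero_le)
    have h := JoinedBy.seg (G := G) i p p
    rw [edist_self] at h
    exact h
  edist_comm u v := by
    congr 1
    ext a
    exact ⟨fun h => h.symm, fun h => h.symm⟩
  edist_triangle u v w := by
    rw [sInf_eq_iInf' {a | G.JoinedBy u v a}, sInf_eq_iInf' {a | G.JoinedBy v w a}]
    rw [ENNReal.iInf_add]
    refine le_iInf fun a => ?_
    rw [ENNReal.add_iInf]
    exact le_iInf fun b => sInf_le (JoinedBy.trans a.2 b.2)

/-- The vertices of the gluing: the points of the surface given by the corners of the squares. -/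
def IsVertex (u : G.Surface) : Prop :=
  ∃ (i : ι) (p : UnitSquare) (k : Fin 4), (p : Plane) = corner k ∧ u = G.pt i p

variable {G}

/-- The length of a continuous path in the surface: the supremum of the sums of the distances
between successive points of the path. -/
noncomputable def pathLength {u v : G.Surface} (γ : Path u v) : ℝ≥0∞ :=
  eVariationOn γ Set.univ

/-- A shortest path: no continuous path with the same endpoints has smaller length. -/
def IsShortestPath {u v : G.Surface} (γ : Path u v) : Prop :=
  ∀ δ : Path u v, pathLength γ ≤ pathLength δ

/-- The intersection of a path with square `i`, as a set of points of that closed unit square. -/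
def inSquare {u v : G.Surface} (γ : Path u v) (i : ι) : Set Plane :=
  {x | ∃ p : UnitSquare, (p : Plane) = x ∧ G.pt i p ∈ Set.range γ}

end SquareGluing

/-- The closed unit square as a subset of the plane. -/
def squareSet : Set Plane := {p | ∀ i, p i ∈ Set.Icc (0 : ℝ) 1}

theorem mem_squareSet {p : Plane} :
    p ∈ squareSet ↔ (0 ≤ p 0 ∧ p 0 ≤ 1) ∧ (0 ≤ p 1 ∧ p 1 ≤ 1) := by
  simp [squareSet, Fin.forall_fin_two, Set.mem_Icc]

theorem plane_ext {p q : Plane} (h0 : p 0 = q 0) (h1 : p 1 = q 1) : p = q := by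
  ext i
  fin_cases i
  · exact h0
  · exact h1

theorem plane_dist (p q : Plane) : dist p q = √((p 0 - q 0) ^ 2 + (p 1 - q 1) ^ 2) := by
  rw [EuclideanSpace.dist_eq]
  simp [Fin.sum_univ_two, Real.dist_eq, sq_abs]

theorem convex_squareSet : Convex ℝ squareSet := by
  intro p hp q hq a b ha hb hab i
  have := convex_Icc (0 : ℝ) 1 (hp i) (hq i) ha hb hab
  simpa using this

theorem corner_mem (k : Fin 4) : corner k ∈ squareSet := by
  rw [mem_squareSet]
  fin_cases k <;> simp [corner]

open Classical in
/-- The point of the unit square given by a point of the plane (a corner, for points outside). -/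
noncomputable def toSquare (p : Plane) : UnitSquare :=
  if h : p ∈ squareSet then ⟨p, h⟩ else ⟨corner 0, corner_mem 0⟩

theorem toSquare_of_mem {p : Plane} (h : p ∈ squareSet) : toSquare p = ⟨p, h⟩ := dif_pos h

theorem coe_toSquare {p : Plane} (h : p ∈ squareSet) : (toSquare p : Plane) = p := by
  rw [toSquare_of_mem h]

theorem toSquare_coe (p : UnitSquare) : toSquare (p : Plane) = p := by
  rw [toSquare_of_mem p.2]

/-- The isometry of the unit square that takes the bottom side to side `k`. -/
noncomputable def turn (k : Fin 4) (Q : Plane) : Plane :=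
  ![!₂[Q 0, Q 1], !₂[1 - Q 1, Q 0], !₂[1 - Q 0, 1 - Q 1], !₂[Q 1, 1 - Q 0]] k

/-- The coordinates, seen from the other square, of a point next to the bottom side. -/
noncomputable def fold (r : Bool) (Q : Plane) : Plane :=
  !₂[if r then 1 - Q 0 else Q 0, -Q 1]

theorem dist_turn (k : Fin 4) (P Q : Plane) : dist (turn k P) (turn k Q) = dist P Q := by
  rw [plane_dist, plane_dist]
  congr 1
  fin_cases k <;> simp [turn] <;> ring

theorem dist_fold (r : Bool) (P Q : Plane) : dist (fold r P) (fold r Q) = dist P Q := by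
  rw [plane_dist, plane_dist]
  congr 1
  cases r <;> simp [fold] <;> ring

theorem turn_turn_neg (k : Fin 4) (Q : Plane) : turn k (turn (-k) Q) = Q := by
  fin_cases k <;> apply plane_ext <;> simp [turn, show -(1 : Fin 4) = 3 from rfl,
    show -(2 : Fin 4) = 2 from rfl, show -(3 : Fin 4) = 1 from rfl]

theorem turn_neg_turn (k : Fin 4) (Q : Plane) : turn (-k) (turn k Q) = Q := by
  simpa using turn_turn_neg (-k) Q

theorem fold_fold (r : Bool) (Q : Plane) : fold r (fold r Q) = Q := by
  cases r <;> apply plane_ext <;> simp [fold]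

theorem turn_mem {k : Fin 4} {Q : Plane} : turn k Q ∈ squareSet ↔ Q ∈ squareSet := by
  rw [mem_squareSet, mem_squareSet]
  fin_cases k <;> simp [turn] <;> constructor <;> intro h <;> grind

theorem turn_smul_sub (k : Fin 4) (P : Plane) (Q : Plane) :
    turn k ((2 : ℝ) • P - Q) = (2 : ℝ) • turn k P - turn k Q := by
  fin_cases k <;> apply plane_ext <;> simp [turn] <;> ring

theorem turn_eq_sidePoint (k : Fin 4) {Q : Plane} (h : Q 1 = 0) :
    turn k Q = sidePoint k (Q 0) := by
  fin_cases k <;> apply plane_ext <;>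
    simp [turn, sidePoint, corner, AffineMap.lineMap_apply, h] <;> ring

theorem sidePoint_mem {k : Fin 4} {t : ℝ} (ht : t ∈ Set.Icc (0 : ℝ) 1) :
    sidePoint k t ∈ squareSet := by
  have := turn_eq_sidePoint k (Q := !₂[t, 0]) rfl
  simp only [Matrix.cons_val_zero] at this
  rw [← this, turn_mem, mem_squareSet]
  simpa using ht

theorem turn_eq_sidePoint_iff {k k' : Fin 4} {Q : Plane} {t : ℝ}
    (h0 : Q 0 ∈ Set.Ioo (0 : ℝ) 1) (h1 : Q 1 ∈ Set.Ico (0 : ℝ) 1)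
    (h : turn k Q = sidePoint k' t) : Q 1 = 0 ∧ k' = k ∧ t = Q 0 := by
  have e := turn_eq_sidePoint k' (Q := !₂[t, 0]) rfl
  simp only [Matrix.cons_val_zero] at e
  rw [← e] at h
  have a := congrArg (fun p : Plane => p 0) h
  have b := congrArg (fun p : Plane => p 1) h
  obtain ⟨h0, h0'⟩ := h0
  obtain ⟨h1, h1'⟩ := h1
  fin_cases k <;> fin_cases k' <;> simp [turn] at a b ⊢ <;>
    first | (constructor <;> linarith) | (exfalso; linarith)

namespace SquareGluing
variable {ι : Type*} (G : SquareGluing ι)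

/-- The point of the surface given by the point `p` of square `i`, for `p` in the plane. -/
noncomputable def loc (i : ι) (p : Plane) : G.Surface := G.pt i (toSquare p)

variable {G}

theorem pt_eq_loc (i : ι) (p : UnitSquare) : G.pt i p = G.loc i p := by
  rw [loc, toSquare_coe]

theorem edist_loc_le {i : ι} {p q : Plane} (hp : p ∈ squareSet) (hq : q ∈ squareSet) :
    edist (G.loc i p) (G.loc i q) ≤ edist p q := by
  have h := JoinedBy.seg (G := G) i (toSquare p) (toSquare q)
  rw [Subtype.edist_eq, coe_toSquare hp, coe_toSquare hq] at h
  exact sInf_le h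

theorem exists_joinedBy_lt {z w : G.Surface} {r : ℝ≥0∞} (h : edist z w < r) :
    ∃ a, G.JoinedBy z w a ∧ a < r := by
  obtain ⟨a, ha, har⟩ := sInf_lt_iff.1 h
  exact ⟨a, ha, har⟩

theorem Glued.symm {x y : ι × UnitSquare} (h : G.Glued x y) : G.Glued y x := by
  obtain ⟨e, t, ht, h1, h2, h3, h4⟩ := h
  refine ⟨G.mate e, if G.reversed e then 1 - t else t, ?_, h3, h4, ?_, ?_⟩
  · split_ifs
    · exact ⟨by linarith [ht.2], by linarith [ht.1]⟩
    · exact ht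
  · rw [G.mate_mate, h1]
  · rw [G.mate_mate, G.reversed_mate, h2]
    congr 1
    split_ifs <;> ring

/-- A property of boundary points preserved by the gluing is a property of points of the surface. -/
theorem of_pt_eq {S : ι × UnitSquare → Prop} (hS : ∀ x y, G.Glued x y → S x → S y)
    {i j : ι} {p q : UnitSquare} (h : G.pt i p = G.pt j q) (hp : S (i, p)) : S (j, q) := by
  have hS' : ∀ x y, G.Glued x y → S x = S y :=
    fun x y hxy => propext ⟨hS x y hxy, hS y x hxy.symm⟩
  have := congrArg (Quot.lift S hS') h
  exact this.mp hp

/-- The open domain `(0, 1) × (-1, 1)` of the development of the two squares next to an edge. -/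
def strip : Set Plane := {Q | Q 0 ∈ Set.Ioo (0 : ℝ) 1 ∧ Q 1 ∈ Set.Ioo (-1 : ℝ) 1}

theorem isOpen_strip : IsOpen strip := by
  have h0 : Continuous fun Q : Plane => Q 0 := by fun_prop
  have h1 : Continuous fun Q : Plane => Q 1 := by fun_prop
  exact (isOpen_Ioo.preimage h0).inter (isOpen_Ioo.preimage h1)

theorem convex_strip : Convex ℝ strip := by
  intro p hp q hq a b ha hb hab
  have h0 := convex_Ioo (0 : ℝ) 1 hp.1 hq.1 ha hb hab
  have h1 := convex_Ioo (-1 : ℝ) 1 hp.2 hq.2 ha hb hab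
  exact ⟨by simpa using h0, by simpa using h1⟩

theorem mem_squareSet_of_strip {Q : Plane} (hQ : Q ∈ strip) (h : 0 ≤ Q 1) : Q ∈ squareSet :=
  mem_squareSet.2 ⟨⟨hQ.1.1.le, hQ.1.2.le⟩, h, hQ.2.2.le⟩

theorem fold_mem_strip {r : Bool} {Q : Plane} (hQ : Q ∈ strip) : fold r Q ∈ strip := by
  obtain ⟨⟨a, b⟩, c, d⟩ := hQ
  cases r
  · exact ⟨⟨by simpa [fold] using a, by simpa [fold] using b⟩,
      by simp [fold]; linarith, by simp [fold]; linarith⟩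
  · exact ⟨⟨by simp [fold]; linarith, by simp [fold]; linarith⟩,
      by simp [fold]; linarith, by simp [fold]; linarith⟩

theorem fold_mem_squareSet {r : Bool} {Q : Plane} (hQ : Q ∈ strip) (h : Q 1 ≤ 0) :
    fold r Q ∈ squareSet :=
  mem_squareSet_of_strip (fold_mem_strip hQ) (by simpa [fold] using h)

variable (G)

/-- `G.Represents e Q x`: the point `x` of a square develops to the point `Q` of the strip around
the edge `e`. -/
def Represents (e : ι × Fin 4) (Q : Plane) (x : ι × UnitSquare) : Prop :=
  (0 ≤ Q 1 ∧ x.1 = e.1 ∧ (x.2 : Plane) = turn e.2 Q) ∨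
    (Q 1 ≤ 0 ∧ x.1 = (G.mate e).1 ∧ (x.2 : Plane) = turn (G.mate e).2 (fold (G.reversed e) Q))

/-- The development of the two squares next to the edge `e`. -/
noncomputable def develop (e : ι × Fin 4) (Q : Plane) : G.Surface :=
  if 0 ≤ Q 1 then G.loc e.1 (turn e.2 Q)
  else G.loc (G.mate e).1 (turn (G.mate e).2 (fold (G.reversed e) Q))

variable {G}

theorem Represents.of_glued {e : ι × Fin 4} {Q : Plane} (hQ : Q ∈ strip) {x y : ι × UnitSquare}
    (hxy : G.Glued x y) (hx : G.Represents e Q x) : G.Represents e Q y := by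
  obtain ⟨e', t, ht, h1, h2, h3, h4⟩ := hxy
  rcases hx with ⟨h, hx1, hx2⟩ | ⟨h, hx1, hx2⟩
  · obtain ⟨a, b, c⟩ := turn_eq_sidePoint_iff hQ.1 ⟨h, hQ.2.2⟩ (hx2.symm.trans h2)
    obtain rfl : e' = e := Prod.ext (h1.symm.trans hx1) b
    refine Or.inr ⟨a.le, h3, ?_⟩
    rw [h4, turn_eq_sidePoint _ (by simp [fold, a])]
    simp [fold, c]
  · have hf := fold_mem_strip (r := G.reversed e) hQ
    obtain ⟨a, b, c⟩ := turn_eq_sidePoint_iff hf.1 ⟨by simpa [fold] using h, hf.2.2⟩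
      (hx2.symm.trans h2)
    obtain rfl : e' = G.mate e := Prod.ext (h1.symm.trans hx1) b
    have a' : Q 1 = 0 := by simpa [fold] using a
    refine Or.inl ⟨a'.ge, by rw [h3, G.mate_mate], ?_⟩
    rw [h4, G.mate_mate, G.reversed_mate, turn_eq_sidePoint _ a', c]
    congr 1
    cases G.reversed e <;> simp [fold]

theorem Represents.develop_eq {e : ι × Fin 4} {Q : Plane} (hQ : Q ∈ strip) {x : ι × UnitSquare}
    (hx : G.Represents e Q x) : G.develop e Q = G.pt x.1 x.2 := by
  rw [pt_eq_loc]
  rcases lt_trichotomy (Q 1) 0 with h | h | h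
  · rcases hx with ⟨h', -⟩ | ⟨-, h1, h2⟩
    · linarith
    · rw [develop, if_neg (not_le.2 h), h1, h2]
  · rw [develop, if_pos h.ge]
    rcases hx with ⟨-, h1, h2⟩ | ⟨-, h1, h2⟩
    · rw [h1, h2]
    · rw [h1, h2]
      refine Quot.sound ⟨e, Q 0, ⟨hQ.1.1.le, hQ.1.2.le⟩, rfl, ?_, rfl, ?_⟩
      · rw [coe_toSquare (turn_mem.2 (mem_squareSet_of_strip hQ h.ge)), turn_eq_sidePoint _ h]
      · rw [coe_toSquare (turn_mem.2 (fold_mem_squareSet hQ h.le)),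
          turn_eq_sidePoint _ (by simp [fold, h])]
        simp [fold]
  · rcases hx with ⟨-, h1, h2⟩ | ⟨h', -⟩
    · rw [develop, if_pos h.le, h1, h2]
    · linarith

theorem exists_represents (e : ι × Fin 4) {Q : Plane} (hQ : Q ∈ strip) :
    ∃ x, G.Represents e Q x := by
  rcases le_total 0 (Q 1) with h | h
  · exact ⟨(e.1, toSquare (turn e.2 Q)), Or.inl ⟨h, rfl,
      coe_toSquare (turn_mem.2 (mem_squareSet_of_strip hQ h))⟩⟩
  · exact ⟨((G.mate e).1, toSquare (turn (G.mate e).2 (fold (G.reversed e) Q))), Or.inr ⟨h, rfl,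
      coe_toSquare (turn_mem.2 (fold_mem_squareSet hQ h))⟩⟩

theorem represents_of_develop_eq {e : ι × Fin 4} {Q : Plane} (hQ : Q ∈ strip) {i : ι}
    {p : UnitSquare} (h : G.develop e Q = G.pt i p) : G.Represents e Q (i, p) := by
  obtain ⟨x, hx⟩ := exists_represents (G := G) e hQ
  exact of_pt_eq (S := G.Represents e Q) (fun _ _ hxy => Represents.of_glued hQ hxy)
    ((hx.develop_eq hQ).symm.trans h) hx

theorem develop_of_nonneg (e : ι × Fin 4) {Q : Plane} (h : 0 ≤ Q 1) :
    G.develop e Q = G.loc e.1 (turn e.2 Q) := if_pos h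

theorem develop_of_nonpos {e : ι × Fin 4} {Q : Plane} (hQ : Q ∈ strip) (h : Q 1 ≤ 0) :
    G.develop e Q = G.loc (G.mate e).1 (turn (G.mate e).2 (fold (G.reversed e) Q)) :=
  Represents.develop_eq hQ (x := (_, toSquare _)) <| Or.inr ⟨h, rfl,
    coe_toSquare (turn_mem.2 (fold_mem_squareSet hQ h))⟩

theorem edist_develop_le {e : ι × Fin 4} {Q Q' : Plane} (hQ : Q ∈ strip) (hQ' : Q' ∈ strip) :
    edist (G.develop e Q) (G.develop e Q') ≤ edist Q Q' := by
  have pos : ∀ {Q Q' : Plane}, Q ∈ strip → Q' ∈ strip → 0 ≤ Q 1 → 0 ≤ Q' 1 →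
      edist (G.develop e Q) (G.develop e Q') ≤ edist Q Q' := by
    intro Q Q' hQ hQ' h h'
    rw [develop_of_nonneg e h, develop_of_nonneg e h']
    refine (edist_loc_le (turn_mem.2 (mem_squareSet_of_strip hQ h))
      (turn_mem.2 (mem_squareSet_of_strip hQ' h'))).trans ?_
    rw [edist_dist, dist_turn, ← edist_dist]
  have neg : ∀ {Q Q' : Plane}, Q ∈ strip → Q' ∈ strip → Q 1 ≤ 0 → Q' 1 ≤ 0 →
      edist (G.develop e Q) (G.develop e Q') ≤ edist Q Q' := by
    intro Q Q' hQ hQ' h h'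
    rw [develop_of_nonpos hQ h, develop_of_nonpos hQ' h']
    refine (edist_loc_le (turn_mem.2 (fold_mem_squareSet hQ h))
      (turn_mem.2 (fold_mem_squareSet hQ' h'))).trans ?_
    rw [edist_dist, dist_turn, dist_fold, ← edist_dist]
  have mixed : ∀ {Q Q' : Plane}, Q ∈ strip → Q' ∈ strip → 0 ≤ Q 1 → Q' 1 ≤ 0 →
      edist (G.develop e Q) (G.develop e Q') ≤ edist Q Q' := by
    intro Q Q' hQ hQ' h h'
    obtain ⟨M, hM, hM1⟩ : ∃ M ∈ segment ℝ Q Q', M 1 = 0 := by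
      rcases h.eq_or_lt with h0 | h0
      · exact ⟨Q, left_mem_segment _ _ _, h0.symm⟩
      have hd : 0 < Q 1 - Q' 1 := by linarith
      refine ⟨(-Q' 1 / (Q 1 - Q' 1)) • Q + (Q 1 / (Q 1 - Q' 1)) • Q',
        ⟨_, _, div_nonneg (by linarith) hd.le, div_nonneg h hd.le, ?_, rfl⟩, ?_⟩
      · field_simp; ring
      · simp; field_simp; ring
    have hMs : M ∈ strip := convex_strip.segment_subset hQ hQ' hM
    calc edist (G.develop e Q) (G.develop e Q')
        ≤ edist (G.develop e Q) (G.develop e M) + edist (G.develop e M) (G.develop e Q') :=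
          edist_triangle _ _ _
      _ ≤ edist Q M + edist M Q' := add_le_add (pos hQ hMs h hM1.ge) (neg hMs hQ' hM1.le h')
      _ = edist Q Q' := by
          rw [edist_dist, edist_dist, edist_dist, ← ENNReal.ofReal_add dist_nonneg dist_nonneg,
            dist_add_dist_of_mem_segment hM]
  rcases le_total 0 (Q 1) with h | h <;> rcases le_total 0 (Q' 1) with h' | h'
  · exact pos hQ hQ' h h'
  · exact mixed hQ hQ' h h'
  · rw [edist_comm, edist_comm Q]
    exact mixed hQ' hQ h' h
  · exact neg hQ hQ' h h'

theorem exists_lift {e : ι × Fin 4} {z z' : G.Surface} {a : ℝ≥0∞} (h : G.JoinedBy z z' a) :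
    ∀ Q, G.develop e Q = z → ∀ R, Metric.eball Q R ⊆ strip → a < R →
      ∃ Q', edist Q Q' ≤ a ∧ G.develop e Q' = z' := by
  induction h with
  | seg i p q =>
    intro Q hQz R hR ha
    have hQ : Q ∈ strip := hR (Metric.mem_eball_self (bot_le.trans_lt ha))
    rcases represents_of_develop_eq hQ hQz with ⟨h, h1, h2⟩ | ⟨h, h1, h2⟩
    · simp only at h1 h2
      have hd : edist Q (turn (-e.2) q) = edist p q := by
        rw [Subtype.edist_eq, h2, edist_dist, edist_dist, ← dist_turn e.2, turn_turn_neg]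
      refine ⟨turn (-e.2) q, hd.le, ?_⟩
      rw [Represents.develop_eq (x := (i, q)) (hR ?_) (Or.inl ⟨?_, h1, ?_⟩)]
      · rw [Metric.mem_eball', hd]
        exact ha
      · exact (mem_squareSet.1 (turn_mem.2 q.2)).2.1
      · rw [turn_turn_neg]
    · simp only at h1 h2
      set r := G.reversed e
      set k := (G.mate e).2
      have hd : edist Q (fold r (turn (-k) q)) = edist p q := by
        rw [Subtype.edist_eq, h2, edist_dist, edist_dist, ← dist_fold r, fold_fold, ← dist_turn k,
          turn_turn_neg]
      refine ⟨fold r (turn (-k) q), hd.le, ?_⟩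
      rw [Represents.develop_eq (x := (i, q)) (hR ?_) (Or.inr ⟨?_, h1, ?_⟩)]
      · rw [Metric.mem_eball', hd]
        exact ha
      · have := (mem_squareSet.1 (turn_mem (k := -k).2 q.2)).2.1
        simpa [fold] using this
      · rw [fold_fold, turn_turn_neg]
  | @trans u v w a b _ _ ih₁ ih₂ =>
    intro Q hQz R hR hab
    obtain ⟨Q', hQQ', hQ'⟩ := ih₁ Q hQz R hR (lt_of_le_of_lt le_self_add hab)
    have ha : a ≠ ∞ := (lt_of_le_of_lt le_self_add hab).ne_top
    have hsub : Metric.eball Q' (R - a) ⊆ Metric.eball Q R := by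
      intro x hx
      rw [Metric.mem_eball'] at hx ⊢
      calc edist Q x ≤ edist Q Q' + edist Q' x := edist_triangle _ _ _
        _ ≤ a + edist Q' x := by gcongr
        _ < R := lt_tsub_iff_left.1 hx
    obtain ⟨Q'', hQQ'', hQ''⟩ := ih₂ Q' hQ' (R - a) (hsub.trans hR) (lt_tsub_iff_left.2 hab)
    exact ⟨Q'', (edist_triangle _ _ _).trans (add_le_add hQQ' hQQ''), hQ''⟩

theorem exists_injOn_develop {e : ι × Fin 4} {P : Plane} (hP : P ∈ strip) (h1 : 0 ≤ P 1) :
    ∃ ρ > 0, Metric.ball P ρ ⊆ strip ∧ Set.InjOn (G.develop e) (Metric.ball P ρ) := by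
  obtain ⟨ρ, hρ, hs⟩ := Metric.isOpen_iff.1 isOpen_strip P hP
  set A := turn e.2 P
  set B := turn (G.mate e).2 (fold (G.reversed e) P)
  obtain ⟨δ, hδ, hsep⟩ : ∃ δ > 0, e.1 = (G.mate e).1 →
      ∀ Q ∈ Metric.ball P δ, ∀ Q' ∈ Metric.ball P δ, Q' 1 ≤ 0 →
        turn e.2 Q ≠ turn (G.mate e).2 (fold (G.reversed e) Q') := by
    rcases h1.eq_or_lt with h0 | h0
    · by_cases hAB : A = B
      · refine ⟨1, one_pos, fun he => ?_⟩
        have hB : B = _ := turn_eq_sidePoint (G.mate e).2 (by simp [fold, ← h0])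
        rw [hB] at hAB
        obtain ⟨-, h, -⟩ := turn_eq_sidePoint_iff hP.1 ⟨h1, hP.2.2⟩ hAB
        exact absurd (Prod.ext he.symm h) (G.mate_ne e)
      · refine ⟨dist A B / 2, half_pos (dist_pos.2 hAB), fun _ Q hQ Q' hQ' _ h => ?_⟩
        rw [Metric.mem_ball, ← dist_turn e.2] at hQ
        rw [Metric.mem_ball, ← dist_fold (G.reversed e), ← dist_turn (G.mate e).2, ← h] at hQ'
        have := dist_triangle_left A B (turn e.2 Q)
        linarith
    · refine ⟨P 1, h0, fun _ Q hQ Q' hQ' hle => ?_⟩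
      have := PiLp.norm_apply_le (p := 2) (Q' - P) 1
      rw [Metric.mem_ball, dist_eq_norm] at hQ'
      simp only [PiLp.sub_apply, Real.norm_eq_abs, abs_le] at this
      linarith [this.1]
  refine ⟨min ρ δ, lt_min hρ hδ, (Metric.ball_subset_ball (min_le_left _ _)).trans hs, ?_⟩
  have hsub := Metric.ball_subset_ball (x := P) (min_le_right ρ δ)
  have hs' := (Metric.ball_subset_ball (x := P) (min_le_left ρ δ)).trans hs
  have inj : ∀ {k} {Q Q' : Plane}, turn k Q = turn k Q' → Q = Q' := by
    intro k Q Q' h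
    rw [← turn_neg_turn k Q, h, turn_neg_turn]
  intro Q hQ Q' hQ' h
  obtain ⟨x, hx⟩ := exists_represents (G := G) e (hs' hQ)
  have hx' := represents_of_develop_eq (hs' hQ') (h.symm.trans (hx.develop_eq (hs' hQ)))
  rcases hx with ⟨a, b, c⟩ | ⟨a, b, c⟩ <;> rcases hx' with ⟨a', b', c'⟩ | ⟨a', b', c'⟩
  · exact inj (c.symm.trans c')
  · exact absurd (c.symm.trans c') (hsep (b.symm.trans b') Q (hsub hQ) Q' (hsub hQ') a')
  · exact absurd (c'.symm.trans c) (hsep (b'.symm.trans b) Q' (hsub hQ') Q (hsub hQ) a)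
  · have := inj (c.symm.trans c')
    rw [← fold_fold (G.reversed e) Q, this, fold_fold]

theorem exists_isometry_develop {e : ι × Fin 4} {P : Plane} (hP : P ∈ strip) (h1 : 0 ≤ P 1) :
    ∃ r > 0, Metric.ball P r ⊆ strip ∧
      (∀ Q ∈ Metric.ball P r, ∀ Q' ∈ Metric.ball P r,
        edist (G.develop e Q) (G.develop e Q') = edist Q Q') ∧
      ∀ z, edist (G.develop e P) z < ENNReal.ofReal r →
        ∃ Q ∈ Metric.ball P r, G.develop e Q = z := by
  obtain ⟨ρ, hρ, hs, hinj⟩ := exists_injOn_develop (G := G) (e := e) hP h1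
  have key : ∀ Q ∈ Metric.ball P (ρ / 2), ∀ z,
      edist (G.develop e Q) z < ENNReal.ofReal (ρ / 2) →
      ∃ Q' ∈ Metric.ball P ρ, G.develop e Q' = z ∧ edist Q Q' ≤ edist (G.develop e Q) z := by
    intro Q hQ z hz
    have hball : Metric.eball Q (ENNReal.ofReal (ρ / 2)) ⊆ Metric.ball P ρ := by
      rw [Metric.eball_ofReal]
      refine Metric.ball_subset_ball' ?_
      rw [Metric.mem_ball] at hQ
      linarith
    have lift : ∀ r, edist (G.develop e Q) z < r → r ≤ ENNReal.ofReal (ρ / 2) →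
        ∃ Q' ∈ Metric.ball P ρ, G.develop e Q' = z ∧ edist Q Q' ≤ r := by
      intro r hr hrρ
      obtain ⟨a, ha, har⟩ := exists_joinedBy_lt hr
      obtain ⟨Q', h1, h2⟩ := exists_lift ha Q rfl _ (hball.trans hs) (har.trans_le hrρ)
      exact ⟨Q', hball (Metric.mem_eball'.2 (h1.trans_lt (har.trans_le hrρ))), h2,
        h1.trans har.le⟩
    obtain ⟨Q', hQ', hz', -⟩ := lift _ hz le_rfl
    refine ⟨Q', hQ', hz', le_of_forall_gt_imp_ge_of_dense fun r hr => ?_⟩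
    obtain ⟨Q'', hQ'', hz'', hr''⟩ := lift (min r (ENNReal.ofReal (ρ / 2))) (lt_min hr hz)
      (min_le_right _ _)
    rw [hinj hQ' hQ'' (hz'.trans hz''.symm)]
    exact hr''.trans (min_le_left _ _)
  have hsub : Metric.ball P (ρ / 4) ⊆ Metric.ball P (ρ / 2) :=
    Metric.ball_subset_ball (by linarith)
  have hsub' : Metric.ball P (ρ / 2) ⊆ Metric.ball P ρ :=
    Metric.ball_subset_ball (by linarith)
  refine ⟨ρ / 4, by positivity, (hsub.trans hsub').trans hs, fun Q hQ Q' hQ' => ?_,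
    fun z hz => ?_⟩
  · have hle : edist (G.develop e Q) (G.develop e Q') ≤ edist Q Q' :=
      edist_develop_le (hs (hsub' (hsub hQ))) (hs (hsub' (hsub hQ')))
    refine le_antisymm hle ?_
    have hlt : edist Q Q' < ENNReal.ofReal (ρ / 2) := by
      rw [edist_dist, ENNReal.ofReal_lt_ofReal_iff (by positivity)]
      have := dist_triangle_right Q Q' P
      rw [Metric.mem_ball] at hQ hQ'
      linarith
    obtain ⟨Q'', h1, h2, h3⟩ := key Q (hsub hQ) (G.develop e Q') (hle.trans_lt hlt)
    rwa [hinj h1 (hsub' (hsub hQ')) h2] at h3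
  · obtain ⟨Q, h1, h2, h3⟩ := key P (Metric.mem_ball_self (by positivity)) z
      (hz.trans_le (ENNReal.ofReal_le_ofReal (by linarith)))
    refine ⟨Q, ?_, h2⟩
    rw [← Metric.eball_ofReal, Metric.mem_eball']
    exact h3.trans_lt hz

theorem exists_turn_mem_strip {p : Plane} (hp : p ∈ squareSet) (hc : ∀ k, p ≠ corner k) :
    ∃ k, turn (-k) p ∈ strip ∧ 0 ≤ turn (-k) p 1 := by
  obtain ⟨⟨a, b⟩, c, d⟩ := mem_squareSet.1 hp
  have hc0 : ¬ (p 0 = 0 ∧ p 1 = 0) := fun h => hc 0 (plane_ext h.1 h.2)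
  have hc1 : ¬ (p 0 = 1 ∧ p 1 = 0) := fun h => hc 1 (plane_ext h.1 h.2)
  have hc2 : ¬ (p 0 = 1 ∧ p 1 = 1) := fun h => hc 2 (plane_ext h.1 h.2)
  have hc3 : ¬ (p 0 = 0 ∧ p 1 = 1) := fun h => hc 3 (plane_ext h.1 h.2)
  rcases a.eq_or_lt with ha | ha
  · have c' : 0 < p 1 := lt_of_le_of_ne c fun h => hc0 ⟨ha.symm, h.symm⟩
    have d' : p 1 < 1 := lt_of_le_of_ne d fun h => hc3 ⟨ha.symm, h⟩
    refine ⟨3, ?_⟩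
    simp only [strip, turn, show -(3 : Fin 4) = 1 from rfl]
    simp
    constructorm* _ ∧ _ <;> linarith
  rcases b.eq_or_lt with hb | hb
  · have c' : 0 < p 1 := lt_of_le_of_ne c fun h => hc1 ⟨hb, h.symm⟩
    have d' : p 1 < 1 := lt_of_le_of_ne d fun h => hc2 ⟨hb, h⟩
    refine ⟨1, ?_⟩
    simp only [strip, turn, show -(1 : Fin 4) = 3 from rfl]
    simp
    constructorm* _ ∧ _ <;> linarith
  rcases d.eq_or_lt with hd | hd
  · refine ⟨2, ?_⟩
    simp only [strip, turn, show -(2 : Fin 4) = 2 from rfl]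
    simp
    constructorm* _ ∧ _ <;> linarith
  · refine ⟨0, ?_⟩
    simp only [strip, turn, show -(0 : Fin 4) = 0 from rfl]
    simp
    constructorm* _ ∧ _ <;> linarith

/-- Away from the corners, a neighbourhood of a point of a square in the surface is isometric to a
disc of the plane, at least half of which lies in the square. -/
theorem exists_isometric_development (i : ι) {p : Plane} (hp : p ∈ squareSet)
    (hc : ∀ k, p ≠ corner k) :
    ∃ (F : Plane → G.Surface) (r : ℝ), 0 < r ∧ (∀ Q ∈ squareSet, F Q = G.loc i Q) ∧
      (∀ Q ∈ Metric.ball p r, ∀ Q' ∈ Metric.ball p r, edist (F Q) (F Q') = edist Q Q') ∧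
      (∀ z, edist (G.loc i p) z < ENNReal.ofReal r → ∃ Q ∈ Metric.ball p r, F Q = z) ∧
      ∀ Q ∈ Metric.ball p r, Q ∈ squareSet ∨ (2 : ℝ) • p - Q ∈ squareSet := by
  obtain ⟨k, hk, hk1⟩ := exists_turn_mem_strip hp hc
  obtain ⟨r, hr, hs, hiso, hsurj⟩ := exists_isometry_develop (G := G) (e := (i, k)) hk hk1
  have hF : ∀ Q ∈ squareSet, G.develop (i, k) (turn (-k) Q) = G.loc i Q := fun Q hQ => by
    rw [develop_of_nonneg _ (mem_squareSet.1 (turn_mem.2 hQ)).2.1, turn_turn_neg]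
  have hball : ∀ Q ∈ Metric.ball p r, turn (-k) Q ∈ Metric.ball (turn (-k) p) r :=
    fun Q hQ => by rwa [Metric.mem_ball, dist_turn]
  refine ⟨fun Q => G.develop (i, k) (turn (-k) Q), r, hr, hF, fun Q hQ Q' hQ' => ?_,
    fun z hz => ?_, fun Q hQ => ?_⟩
  · rw [hiso _ (hball Q hQ) _ (hball Q' hQ'), edist_dist, dist_turn, ← edist_dist]
  · rw [← hF p hp] at hz
    obtain ⟨Q, hQ, rfl⟩ := hsurj z hz
    refine ⟨turn k Q, ?_, by simp only [turn_neg_turn]⟩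
    rw [Metric.mem_ball, ← dist_turn (-k), turn_neg_turn]
    exact hQ
  · rcases le_total 0 (turn (-k) Q 1) with h | h
    · exact Or.inl (turn_mem.1 (mem_squareSet_of_strip (hs (hball Q hQ)) h))
    · right
      have hQ' : (2 : ℝ) • p - Q ∈ Metric.ball p r := by
        rw [Metric.mem_ball, dist_eq_norm] at hQ ⊢
        rwa [show (2 : ℝ) • p - Q - p = -(Q - p) by rw [two_smul]; abel, norm_neg]
      rw [← turn_mem (k := -k)]
      refine mem_squareSet_of_strip (hs (hball _ hQ')) ?_
      rw [turn_smul_sub]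
      simp only [PiLp.sub_apply, PiLp.smul_apply, smul_eq_mul]
      linarith

end SquareGluing

theorem sidePoint_zero (k : Fin 4) : sidePoint k 0 = corner k := by simp [sidePoint]

theorem sidePoint_one (k : Fin 4) : sidePoint k 1 = corner (k + 1) := by simp [sidePoint]

theorem dist_sidePoint (k : Fin 4) (s t : ℝ) : dist (sidePoint k s) (sidePoint k t) = |s - t| := by
  have h : dist (corner k) (corner (k + 1)) = 1 := by
    rw [plane_dist]
    fin_cases k <;> simp [corner]
  rw [sidePoint, sidePoint, dist_lineMap_lineMap, h, mul_one, Real.dist_eq]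

theorem corner_eq_sidePoint_of_dist_lt {k k' : Fin 4} {t : ℝ}
    (h : dist (sidePoint k t) (corner k') < 1) :
    ∃ s : ℝ, (s = 0 ∨ s = 1) ∧ corner k' = sidePoint k s := by
  rcases eq_or_ne k' k with rfl | h0
  · exact ⟨0, Or.inl rfl, (sidePoint_zero _).symm⟩
  rcases eq_or_ne k' (k + 1) with rfl | h1
  · exact ⟨1, Or.inr rfl, (sidePoint_one _).symm⟩
  exfalso
  rw [plane_dist, Real.sqrt_lt' one_pos] at h
  have e := turn_eq_sidePoint k (Q := !₂[t, 0]) rfl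
  simp only [Matrix.cons_val_zero] at e
  rw [← e] at h
  fin_cases k <;> fin_cases k' <;> simp at h0 h1 <;> simp [turn, corner] at h <;>
    nlinarith [sq_nonneg t, sq_nonneg (1 - t)]

theorem corner_eq_of_dist_lt {k k' : Fin 4} (h : dist (corner k) (corner k') < 1) :
    corner k = corner k' := by
  obtain ⟨s, hs, h'⟩ := corner_eq_sidePoint_of_dist_lt (by rwa [sidePoint_zero k])
  rcases hs with rfl | rfl
  · rw [h', sidePoint_zero]
  · rw [h', ← sidePoint_zero, dist_sidePoint] at h
    norm_num at h

namespace SquareGluing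
variable {ι : Type*} {G : SquareGluing ι}

theorem exists_eq_loc (z : G.Surface) : ∃ i, ∃ p ∈ squareSet, z = G.loc i p := by
  obtain ⟨⟨i, p⟩, rfl⟩ := Quot.exists_rep z
  exact ⟨i, p, p.2, pt_eq_loc i p⟩

variable (G) in
/-- The point `x` of a square is within `ρ` of a corner that represents the point `w`. -/
def NearCorner (w : G.Surface) (ρ : ℝ≥0∞) (x : ι × UnitSquare) : Prop :=
  ∃ k, G.loc x.1 (corner k) = w ∧ edist (x.2 : Plane) (corner k) ≤ ρ

theorem NearCorner.of_glued {w : G.Surface} {ρ : ℝ≥0∞} (hρ : ρ < 1) {x y : ι × UnitSquare}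
    (hxy : G.Glued x y) (hx : G.NearCorner w ρ x) : G.NearCorner w ρ y := by
  obtain ⟨e, t, ht, h1, h2, h3, h4⟩ := hxy
  obtain ⟨k, hk, hd⟩ := hx
  have hd' := hd.trans_lt hρ
  rw [h2, edist_dist, ← ENNReal.ofReal_one, ENNReal.ofReal_lt_ofReal_iff one_pos] at hd'
  obtain ⟨s, hs, hks⟩ := corner_eq_sidePoint_of_dist_lt hd'
  set flip : ℝ → ℝ := fun t => if G.reversed e then 1 - t else t with hflip
  obtain ⟨k', hk'⟩ : ∃ k', corner k' = sidePoint (G.mate e).2 (flip s) := by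
    have : flip s = 0 ∨ flip s = 1 := by
      simp only [hflip]
      rcases hs with rfl | rfl <;> cases G.reversed e <;> simp
    rcases this with h | h <;> rw [h]
    · exact ⟨_, (sidePoint_zero _).symm⟩
    · exact ⟨_, (sidePoint_one _).symm⟩
  have hdist : |flip t - flip s| = |t - s| := by
    simp only [hflip]
    split_ifs
    · rw [abs_sub_comm]; congr 1; ring
    · rfl
  refine ⟨k', ?_, ?_⟩
  · rw [← hk, h1, h3]
    refine (Quot.sound ⟨e, s, ?_, rfl, ?_, rfl, ?_⟩).symm
    · rcases hs with rfl | rfl <;> simp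
    · rw [coe_toSquare (corner_mem k), hks]
    · rw [coe_toSquare (corner_mem k'), hk']
  · rw [h4, hk', edist_dist, dist_sidePoint, hdist, ← dist_sidePoint e.2, ← hks, ← h2,
      ← edist_dist]
    exact hd

theorem NearCorner.of_joinedBy {w z z' : G.Surface} {a : ℝ≥0∞} (h : G.JoinedBy z z' a) :
    ∀ ρ : ℝ≥0∞, ρ + a < 1 → (∀ i p, z = G.pt i p → G.NearCorner w ρ (i, p)) →
      ∀ i p, z' = G.pt i p → G.NearCorner w (ρ + a) (i, p) := by
  induction h with
  | seg i p q =>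
    intro ρ hρ hz j q' hq'
    refine of_pt_eq (fun _ _ => NearCorner.of_glued hρ) hq' ?_
    obtain ⟨k, hk, hd⟩ := hz i p rfl
    refine ⟨k, hk, (edist_triangle (q : Plane) p _).trans ?_⟩
    rw [add_comm ρ, edist_comm p q]
    exact add_le_add_right hd _
  | trans _ _ ih₁ ih₂ =>
    intro ρ hρ hz
    rw [← add_assoc] at hρ ⊢
    exact ih₂ _ hρ (ih₁ ρ (lt_of_le_of_lt le_self_add hρ) hz)

theorem exists_eq_corner_of_loc_eq {i j : ι} {p : Plane} {k : Fin 4} (hp : p ∈ squareSet)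
    (h : G.loc i p = G.loc j (corner k)) : ∃ k', p = corner k' := by
  have := of_pt_eq (S := G.NearCorner (G.loc j (corner k)) 0)
    (fun _ _ => NearCorner.of_glued zero_lt_one) (h.symm) ⟨k, rfl, by
      rw [coe_toSquare (corner_mem k), edist_self]⟩
  obtain ⟨k', -, hk'⟩ := this
  rw [nonpos_iff_eq_zero, edist_eq_zero, coe_toSquare hp] at hk'
  exact ⟨k', hk'⟩

theorem not_isVertex_loc {i : ι} {p : Plane} (hp : p ∈ squareSet) (hc : ∀ k, p ≠ corner k) :
    ¬ G.IsVertex (G.loc i p) := by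
  rintro ⟨j, q, k, hq, h⟩
  rw [pt_eq_loc, hq] at h
  obtain ⟨k', hk'⟩ := exists_eq_corner_of_loc_eq hp h
  exact hc k' hk'

theorem eq_of_loc_eq {i j : ι} {p q : Plane} (h0 : p 0 ∈ Set.Ioo (0 : ℝ) 1)
    (h1 : p 1 ∈ Set.Ioo (0 : ℝ) 1) (hq : q ∈ squareSet) (h : G.loc i p = G.loc j q) : p = q := by
  have hp : p ∈ squareSet := mem_squareSet.2 ⟨⟨h0.1.le, h0.2.le⟩, h1.1.le, h1.2.le⟩
  have := of_pt_eq (S := fun x => (x.2 : Plane) = p) (fun x y hxy hx => ?_) h (coe_toSquare hp)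
  · rw [← this, coe_toSquare hq]
  · obtain ⟨e, t, -, -, h2, -⟩ := hxy
    have ht : turn 0 p = p := plane_ext rfl rfl
    exact absurd (turn_eq_sidePoint_iff h0 ⟨h1.1.le, h1.2⟩ (ht.trans (hx.symm.trans h2))).1 h1.1.ne'

theorem eq_of_edist_eq_zero {z z' : G.Surface} (h : edist z z' = 0) : z = z' := by
  have smooth : ∀ {i : ι} {p : Plane} {z' : G.Surface}, p ∈ squareSet → (∀ k, p ≠ corner k) →
      edist (G.loc i p) z' = 0 → G.loc i p = z' := by
    intro i p z' hp hc h
    obtain ⟨F, r, hr, hF, hiso, hsurj, -⟩ := exists_isometric_development (G := G) i hp hc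
    obtain ⟨Q, hQ, rfl⟩ := hsurj z' (by rw [h]; exact ENNReal.ofReal_pos.2 hr)
    rw [← hF p hp, hiso p (Metric.mem_ball_self hr) Q hQ, edist_eq_zero] at h
    rw [← hF p hp, h]
  obtain ⟨i, p, hp, rfl⟩ := exists_eq_loc z
  obtain ⟨j, q, hq, rfl⟩ := exists_eq_loc z'
  by_cases hcp : ∀ k, p ≠ corner k
  · exact smooth hp hcp h
  by_cases hcq : ∀ k, q ≠ corner k
  · exact (smooth hq hcq (by rwa [edist_comm])).symm
  push Not at hcp hcq
  obtain ⟨k, rfl⟩ := hcp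
  obtain ⟨k', rfl⟩ := hcq
  obtain ⟨a, ha, ha1⟩ := exists_joinedBy_lt (h.trans_lt one_pos)
  obtain ⟨l, hl, hd⟩ := NearCorner.of_joinedBy (w := G.loc i (corner k)) ha 0 (by simpa using ha1)
    (fun j q hjq => of_pt_eq (fun _ _ => NearCorner.of_glued one_pos) hjq
      ⟨k, rfl, by rw [coe_toSquare (corner_mem k), edist_self]⟩) j _ rfl
  have hd' := hd.trans_lt (by simpa using ha1 : 0 + a < 1)
  rw [coe_toSquare (corner_mem k'), edist_dist, ← ENNReal.ofReal_one,
    ENNReal.ofReal_lt_ofReal_iff one_pos] at hd'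
  rw [← hl, corner_eq_of_dist_lt hd']

theorem eVariationOn_eq_add {α E : Type*} [LinearOrder α] [PseudoEMetricSpace E] (f : α → E)
    (x : α) :
    eVariationOn f Set.univ = eVariationOn f (Set.Iic x) + eVariationOn f (Set.Ici x) := by
  rw [← eVariationOn.union f isGreatest_Iic isLeast_Ici, Set.Iic_union_Ici]

theorem exists_path_segment (i : ι) (p q : UnitSquare) :
    ∃ δ : Path (G.pt i p) (G.pt i q), pathLength δ ≤ edist p q := by
  set c : ℝ → G.Surface := fun s => G.loc i (AffineMap.lineMap (p : Plane) (q : Plane) s) with hc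
  have hmem : ∀ s ∈ Set.Icc (0 : ℝ) 1, AffineMap.lineMap (p : Plane) (q : Plane) s ∈ squareSet :=
    fun s hs => convex_squareSet.lineMap_mem p.2 q.2 hs
  have hlip : LipschitzOnWith (nndist p q) c (Set.Icc 0 1) := by
    intro s hs t ht
    refine (edist_loc_le (hmem s hs) (hmem t ht)).trans ?_
    rw [edist_dist, dist_lineMap_lineMap, ENNReal.ofReal_mul dist_nonneg, ← edist_dist,
      ← edist_dist, mul_comm, ← edist_nndist, Subtype.edist_eq]
  refine ⟨⟨⟨fun s => c s, ?_⟩, ?_, ?_⟩, ?_⟩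
  · exact hlip.continuousOn.comp_continuous continuous_subtype_val fun s => s.2
  · simp [hc, pt_eq_loc]
  · simp [hc, pt_eq_loc]
  · have h1 : eVariationOn (c ∘ ((↑) : unitInterval → ℝ)) Set.univ ≤
        nndist p q * eVariationOn ((↑) : unitInterval → ℝ) Set.univ :=
      hlip.comp_eVariationOn_le fun s _ => s.2
    have h2 : eVariationOn ((↑) : unitInterval → ℝ) Set.univ ≤ 1 := by
      have := MonotoneOn.eVariationOn_eq (f := ((↑) : unitInterval → ℝ)) (s := Set.univ)
        (fun _ _ _ _ h => h) (Set.mem_univ 0) (Set.mem_univ 1)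
      have huniv : (Set.univ : Set unitInterval) ∩ Set.Icc 0 1 = Set.univ :=
        Set.inter_eq_left.2 fun x _ => ⟨unitInterval.nonneg', unitInterval.le_one'⟩
      rw [huniv] at this
      simp [this]
    calc eVariationOn (c ∘ ((↑) : unitInterval → ℝ)) Set.univ
        ≤ nndist p q * 1 := h1.trans (by gcongr)
      _ = edist p q := by rw [mul_one, edist_nndist]

theorem pathLength_trans_le {u v w : G.Surface} (γ : Path u v) (δ : Path v w) :
    pathLength (γ.trans δ) ≤ pathLength γ + pathLength δ := by
  have hhalf : (1 / 2 : ℝ) ∈ Set.Icc (0 : ℝ) 1 := by norm_num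
  rw [pathLength, eVariationOn_eq_add _ (⟨1 / 2, hhalf⟩ : unitInterval)]
  refine add_le_add ?_ ?_
  · have h : Set.EqOn (γ.trans δ)
        (γ ∘ fun t : unitInterval => Set.projIcc 0 1 zero_le_one (2 * (t : ℝ)))
        (Set.Iic ⟨1 / 2, hhalf⟩) := by
      intro t ht
      have ht' : (t : ℝ) ≤ 1 / 2 := ht
      show ite _ _ _ = _
      rw [if_pos ht']
      rfl
    rw [eVariationOn.congr h]
    exact eVariationOn.comp_le_of_monotoneOn _ _
      (fun a _ b _ hab => Set.monotone_projIcc _ (by simpa using hab)) fun _ _ => Set.mem_univ _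
  · have h : Set.EqOn (γ.trans δ)
        (δ ∘ fun t : unitInterval => Set.projIcc 0 1 zero_le_one (2 * (t : ℝ) - 1))
        (Set.Ici ⟨1 / 2, hhalf⟩) := by
      intro t ht
      have ht' : 1 / 2 ≤ (t : ℝ) := ht
      show ite _ _ _ = _
      split_ifs with h
      · have : (t : ℝ) = 1 / 2 := le_antisymm h ht'
        rw [Function.comp_apply, this, Path.extend_of_one_le _ (by norm_num),
          Set.projIcc_of_le_left _ (by norm_num)]
        exact δ.source.symm
      · rfl
    rw [eVariationOn.congr h]
    exact eVariationOn.comp_le_of_monotoneOn _ _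
      (fun a _ b _ hab => Set.monotone_projIcc _ (by simpa using hab)) fun _ _ => Set.mem_univ _

theorem JoinedBy.exists_path {u v : G.Surface} {a : ℝ≥0∞} (h : G.JoinedBy u v a) :
    ∃ δ : Path u v, pathLength δ ≤ a := by
  induction h with
  | seg i p q => exact exists_path_segment i p q
  | trans _ _ ih₁ ih₂ =>
    obtain ⟨γ, hγ⟩ := ih₁
    obtain ⟨δ, hδ⟩ := ih₂
    exact ⟨γ.trans δ, (pathLength_trans_le γ δ).trans (add_le_add hγ hδ)⟩

theorem IsShortestPath.pathLength_le_edist {u v : G.Surface} {π : Path u v}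
    (hπ : IsShortestPath π) : pathLength π ≤ edist u v := by
  refine le_sInf fun a ha => ?_
  obtain ⟨δ, hδ⟩ := JoinedBy.exists_path ha
  exact (hπ δ).trans hδ

theorem edist_ne_top_of_path {u v : G.Surface} (π : Path u v) : edist u v ≠ ∞ := by
  have h : Set.range π ⊆ Metric.eball u ∞ :=
    (isPreconnected_range π.continuous).subset_isClopen
      ⟨Metric.isClosed_eball_top, Metric.isOpen_eball⟩
      ⟨u, ⟨0, π.source⟩, Metric.mem_eball_self (by simp)⟩
  exact (Metric.mem_eball'.1 (h ⟨1, π.target⟩)).ne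

theorem add_edist_add_le_pathLength {u v : G.Surface} (π : Path u v) {s t : unitInterval}
    (h : s ≤ t) : edist u (π s) + edist (π s) (π t) + edist (π t) v ≤ pathLength π := by
  rw [pathLength, eVariationOn_eq_add _ t]
  have hs : eVariationOn π (Set.Iic s) + eVariationOn π (Set.Icc s t) ≤
      eVariationOn π (Set.Iic t) := by
    rw [← eVariationOn.union π isGreatest_Iic (isLeast_Icc h)]
    exact eVariationOn.mono _ (Set.union_subset (Set.Iic_subset_Iic.2 h) fun x hx => hx.2)
  refine add_le_add (le_trans (add_le_add ?_ ?_) hs) ?_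
  · have := eVariationOn.edist_le π (s := Set.Iic s) (x := 0) (y := s) unitInterval.nonneg'
      Set.self_mem_Iic
    rwa [π.source] at this
  · exact eVariationOn.edist_le π (Set.left_mem_Icc.2 h) (Set.right_mem_Icc.2 h)
  · have := eVariationOn.edist_le π (s := Set.Ici t) (x := t) (y := 1) Set.self_mem_Ici
      unitInterval.le_one'
    rwa [π.target] at this

/-- `y` is a unit speed geodesic of length `L` in the surface, with vertices as endpoints. -/
structure IsVertexGeodesic (G : SquareGluing ι) (L : ℝ) (y : ℝ → G.Surface) : Prop where
  nonneg : 0 ≤ L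
  source : G.IsVertex (y 0)
  target : G.IsVertex (y L)
  edist_eq : ∀ s ∈ Set.Icc 0 L, ∀ t ∈ Set.Icc 0 L, edist (y s) (y t) = ENNReal.ofReal |s - t|

theorem IsShortestPath.exists_isVertexGeodesic {u v : G.Surface} (hu : G.IsVertex u)
    (hv : G.IsVertex v) {π : Path u v} (hπ : IsShortestPath π) :
    ∃ L y, G.IsVertexGeodesic L y ∧ Set.range π = y '' Set.Icc 0 L := by
  have hle : ∀ {s t : unitInterval}, s ≤ t →
      edist u (π s) + edist (π s) (π t) + edist (π t) v ≤ edist u v :=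
    fun h => (add_edist_add_le_pathLength π h).trans hπ.pathLength_le_edist
  have hfin : ∀ s, edist u (π s) ≠ ∞ := fun s =>
    ne_top_of_le_ne_top (edist_ne_top_of_path π)
      ((le_self_add.trans le_self_add).trans (hle (le_refl s)))
  set τ : unitInterval → ℝ := fun s => (edist u (π s)).toReal with hτ
  have hcont : Continuous τ :=
    ENNReal.continuousOn_toReal.comp_continuous (by fun_prop) fun s => hfin s
  have hτ0 : τ 0 = 0 := by simp [hτ, π.source]
  have hτ1 : τ 1 = (edist u v).toReal := by simp [hτ, π.target]
  have hτnn : ∀ s, 0 ≤ τ s := fun s => ENNReal.toReal_nonneg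
  have hτle : ∀ s, τ s ≤ τ 1 := fun s => by
    rw [hτ1]
    exact ENNReal.toReal_mono (edist_ne_top_of_path π)
      ((le_self_add.trans le_self_add).trans (hle (le_refl s)))
  have hadd : ∀ {s t : unitInterval}, s ≤ t →
      edist u (π s) + edist (π s) (π t) = edist u (π t) := by
    intro s t h
    refine le_antisymm ?_ (edist_triangle _ _ _)
    have h1 := (hle h).trans (edist_triangle u (π t) v)
    have h2 : edist (π t) v ≠ ∞ := ne_top_of_le_ne_top (edist_ne_top_of_path π)
      (le_add_self.trans (hle h))
    exact (ENNReal.add_le_add_iff_right h2).1 h1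
  have hmono : ∀ {s t : unitInterval}, s ≤ t → edist (π s) (π t) = ENNReal.ofReal |τ s - τ t| := by
    intro s t h
    have h0 := hadd h
    have h1 : edist (π s) (π t) ≠ ∞ := ne_top_of_le_ne_top (hfin t) (le_add_self.trans h0.le)
    have h2 : τ s + (edist (π s) (π t)).toReal = τ t := by
      simp only [hτ]
      rw [← ENNReal.toReal_add (hfin s) h1, h0]
    have h3 : τ s - τ t = -(edist (π s) (π t)).toReal := by linarith
    rw [h3, abs_neg, abs_of_nonneg ENNReal.toReal_nonneg, ENNReal.ofReal_toReal h1]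
  have hdist : ∀ s t : unitInterval, edist (π s) (π t) = ENNReal.ofReal |τ s - τ t| := by
    intro s t
    rcases le_total s t with h | h
    · exact hmono h
    · rw [edist_comm, abs_sub_comm]
      exact hmono h
  have hsurj : ∀ c ∈ Set.Icc 0 (τ 1), ∃ s, τ s = c := by
    intro c hc
    rw [← hτ0] at hc
    exact mem_range_of_exists_le_of_exists_ge hcont ⟨0, hc.1⟩ ⟨1, hc.2⟩
  choose! σ hσ using hsurj
  have heq : ∀ s, π (σ (τ s)) = π s := fun s => eq_of_edist_eq_zero (by
    rw [hdist, hσ _ ⟨hτnn s, hτle s⟩]; simp)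
  refine ⟨τ 1, fun c => π (σ c), ⟨hτnn 1, ?_, ?_, fun s hs t ht => ?_⟩, ?_⟩
  · rw [← hτ0, heq, π.source]
    exact hu
  · simp only [heq, π.target]
    exact hv
  · simp only [hdist, hσ s hs, hσ t ht]
  · refine Set.Subset.antisymm ?_ ?_
    · rintro _ ⟨s, rfl⟩
      exact ⟨τ s, ⟨hτnn s, hτle s⟩, heq s⟩
    · rintro _ ⟨c, -, rfl⟩
      exact ⟨σ c, rfl⟩

/-- The curve `y` passes at time `s ∈ [0, L]` through the point `p` of square `i`. -/
def Meets (L : ℝ) (y : ℝ → G.Surface) (i : ι) (p : Plane) (s : ℝ) : Prop :=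
  p ∈ squareSet ∧ s ∈ Set.Icc 0 L ∧ G.loc i p = y s

/-- Between the times `a` and `b`, the curve `y` runs at unit speed along the line
`s ↦ p + s • w`, which lies in square `i` at no other time. -/
structure IsChord (L : ℝ) (y : ℝ → G.Surface) (i : ι) (p w : Plane) (a b : ℝ) : Prop where
  norm_eq : ‖w‖ = 1
  lt : a < b
  meets : ∀ s ∈ Set.Icc a b, Meets L y i (p + s • w) s
  mem_Icc : ∀ s, p + s • w ∈ squareSet → s ∈ Set.Icc a b

theorem isClosed_squareSet : IsClosed squareSet := by
  have : squareSet = ⋂ i : Fin 2, (fun p : Plane => p i) ⁻¹' Set.Icc 0 1 := by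
    ext p
    simp [squareSet]
  rw [this]
  exact isClosed_iInter fun i => isClosed_Icc.preimage (by fun_prop)

theorem isBounded_squareSet : Bornology.IsBounded squareSet := by
  refine (Metric.isBounded_iff_subset_closedBall 0).2 ⟨2, fun p hp => ?_⟩
  obtain ⟨⟨a, b⟩, c, d⟩ := mem_squareSet.1 hp
  rw [Metric.mem_closedBall, plane_dist]
  refine Real.sqrt_le_iff.2 ⟨by norm_num, ?_⟩
  simp only [PiLp.zero_apply, sub_zero]
  nlinarith

theorem ne_corner_of_mem_Ioo {p w : Plane} (hw : w ≠ 0) {a b t : ℝ} (ht : t ∈ Set.Ioo a b)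
    (ha : p + a • w ∈ squareSet) (hb : p + b • w ∈ squareSet) (k : Fin 4) :
    p + t • w ≠ corner k := by
  intro h
  have hk : ∀ j, corner k j = 0 ∨ corner k j = 1 := by
    intro j
    fin_cases k <;> fin_cases j <;> simp [corner]
  have hz : ∀ j, w j = 0 := by
    intro j
    have h1 : p j + t * w j = corner k j := by rw [← h]; simp
    have h2 : p j + a * w j ∈ Set.Icc (0 : ℝ) 1 := by simpa using ha j
    have h3 : p j + b * w j ∈ Set.Icc (0 : ℝ) 1 := by simpa using hb j
    have hta := sub_pos.2 ht.1
    have htb := sub_pos.2 ht.2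
    rcases hk j with h0 | h0 <;> rw [h0] at h1
    · have i1 : 0 ≤ (b - t) * w j := by linarith [h3.1]
      have i2 : (t - a) * w j ≤ 0 := by linarith [h2.1]
      exact le_antisymm (nonpos_of_mul_nonpos_right i2 hta) (nonneg_of_mul_nonneg_right i1 htb)
    · have i1 : (b - t) * w j ≤ 0 := by linarith [h3.2]
      have i2 : 0 ≤ (t - a) * w j := by linarith [h2.2]
      exact le_antisymm (nonpos_of_mul_nonpos_right i1 htb) (nonneg_of_mul_nonneg_right i2 hta)
  exact hw (plane_ext (hz 0) (hz 1))

variable {L : ℝ} {y : ℝ → G.Surface} (hy : G.IsVertexGeodesic L y) {i : ι}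
include hy

theorem IsVertexGeodesic.abs_sub_le_dist {p q : Plane} {s t : ℝ} (hp : Meets L y i p s)
    (hq : Meets L y i q t) : |s - t| ≤ dist p q := by
  have h := edist_loc_le (G := G) (i := i) hp.1 hq.1
  rw [hp.2.2, hq.2.2, hy.edist_eq s hp.2.1 t hq.2.1, edist_dist] at h
  exact (ENNReal.ofReal_le_ofReal_iff dist_nonneg).1 h

theorem IsVertexGeodesic.mem_Ioo {p : Plane} {s : ℝ} (hp : Meets L y i p s)
    (hc : ∀ k, p ≠ corner k) : s ∈ Set.Ioo 0 L := by
  obtain ⟨hp, hs, h⟩ := hp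
  have hv := not_isVertex_loc (G := G) (i := i) hp hc
  rw [h] at hv
  refine ⟨lt_of_le_of_ne hs.1 ?_, lt_of_le_of_ne hs.2 ?_⟩
  · rintro rfl
    exact hv hy.source
  · rintro rfl
    exact hv hy.target

/-- Away from the corners, the geodesic is locally a straight line in the development. -/
theorem IsVertexGeodesic.exists_straight {q : Plane} {s : ℝ} (hq : Meets L y i q s)
    (hc : ∀ k, q ≠ corner k) :
    ∃ (F : Plane → G.Surface) (v : Plane) (ε : ℝ), 0 < ε ∧ ‖v‖ = 1 ∧
      (∀ Q ∈ squareSet, F Q = G.loc i Q) ∧ Set.InjOn F (Metric.ball q ε) ∧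
      (∀ Q ∈ Metric.ball q ε, Q ∈ squareSet ∨ (2 : ℝ) • q - Q ∈ squareSet) ∧
      ∀ τ, |τ| < ε → s + τ ∈ Set.Icc 0 L ∧ F (q + τ • v) = y (s + τ) := by
  obtain ⟨F, r, hr, hF, hiso, hsurj, hhalf⟩ := exists_isometric_development (G := G) i hq.1 hc
  obtain ⟨hs0, hsL⟩ := hy.mem_Ioo hq hc
  obtain ⟨η, hη, hηr, hη0, hηL⟩ : ∃ η > 0, η < r ∧ η < s ∧ η < L - s := by
    obtain ⟨η, h1, h2⟩ := exists_between (lt_min hr (lt_min hs0 (sub_pos.2 hsL)))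
    rw [lt_min_iff, lt_min_iff] at h2
    exact ⟨η, h1, h2⟩
  have hmem : ∀ τ, |τ| ≤ η → s + τ ∈ Set.Icc 0 L := by
    intro τ hτ
    obtain ⟨h1, h2⟩ := abs_le.1 hτ
    exact ⟨by linarith, by linarith⟩
  have hex : ∀ τ, |τ| ≤ η → ∃ Q ∈ Metric.ball q r, F Q = y (s + τ) := by
    intro τ hτ
    refine hsurj _ ?_
    rw [hq.2.2, hy.edist_eq s hq.2.1 _ (hmem τ hτ), ENNReal.ofReal_lt_ofReal_iff hr]
    simpa using hτ.trans_lt hηr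
  choose! Q hQ hFQ using hex
  have hdist : ∀ τ τ', |τ| ≤ η → |τ'| ≤ η → dist (Q τ) (Q τ') = |τ - τ'| := by
    intro τ τ' hτ hτ'
    have h := hiso _ (hQ τ hτ) _ (hQ τ' hτ')
    rw [hFQ τ hτ, hFQ τ' hτ', hy.edist_eq _ (hmem τ hτ) _ (hmem τ' hτ'), edist_dist,
      ENNReal.ofReal_eq_ofReal_iff (abs_nonneg _) dist_nonneg] at h
    rw [← h]
    congr 1
    ring
  have hQ0 : Q 0 = q := by
    have h := hiso _ (hQ 0 (by simpa using hη.le)) q (Metric.mem_ball_self hr)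
    rw [hFQ 0 (by simpa using hη.le), hF q hq.1, hq.2.2, add_zero, edist_self] at h
    exact edist_eq_zero.1 h.symm
  have hηη : |η| ≤ η := (abs_of_pos hη).le
  have hnη : |-η| ≤ η := by rw [abs_neg]; exact hηη
  have hAB : dist (Q (-η)) (Q η) = 2 * η := by
    rw [hdist _ _ hnη hηη, abs_of_neg (by linarith)]
    ring
  have hline : ∀ τ, |τ| ≤ η →
      Q τ = AffineMap.lineMap (Q (-η)) (Q η) ((τ + η) / (2 * η)) := by
    intro τ hτ
    obtain ⟨h1, h2⟩ := abs_le.1 hτ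
    apply eq_lineMap_of_dist_eq_mul_of_dist_eq_mul
    · rw [hAB, hdist _ _ hnη hτ, abs_of_nonpos (by linarith)]
      field_simp
      ring
    · rw [hAB, hdist _ _ hτ hηη, abs_of_nonpos (by linarith)]
      field_simp
      ring
  set v : Plane := (2 * η)⁻¹ • (Q η - Q (-η)) with hv
  have hQv : ∀ τ, |τ| ≤ η → Q τ = q + τ • v := by
    intro τ hτ
    rw [← hQ0, hline τ hτ, hline 0 (by simpa using hη.le), hv]
    simp only [AffineMap.lineMap_apply, vsub_eq_sub, vadd_eq_add, smul_smul]
    rw [add_right_comm, ← add_smul]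
    congr 2
    field_simp
    ring
  refine ⟨F, v, η, hη, ?_, hF, fun P hP P' hP' h => ?_, fun P hP => hhalf P ?_, fun τ hτ => ?_⟩
  · rw [hv, norm_smul, ← dist_eq_norm, dist_comm, hAB, Real.norm_of_nonneg (by positivity)]
    field_simp
  · have hsub := Metric.ball_subset_ball (x := q) hηr.le
    have h' := hiso P (hsub hP) P' (hsub hP')
    rw [h, edist_self] at h'
    exact edist_eq_zero.1 h'.symm
  · exact Metric.ball_subset_ball hηr.le hP
  · rw [← hQv τ hτ.le, hFQ τ hτ.le]
    exact ⟨hmem τ hτ.le, rfl⟩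

theorem IsVertexGeodesic.isClosed_meets (p : Plane) {w : Plane} (hw : ‖w‖ = 1) :
    IsClosed {t : ℝ | Meets L y i (p + t • w) t} := by
  have hγ : Continuous fun t : ℝ => p + t • w := by fun_prop
  refine isClosed_of_closure_subset fun t ht => ?_
  have hsq : p + t • w ∈ squareSet := closure_minimal
    (fun t (ht : Meets L y i (p + t • w) t) => ht.1) (isClosed_squareSet.preimage hγ) ht
  have hIcc : t ∈ Set.Icc 0 L := closure_minimal
    (fun t (ht : Meets L y i (p + t • w) t) => ht.2.1) isClosed_Icc ht
  refine ⟨hsq, hIcc, eq_of_edist_eq_zero ?_⟩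
  have hle : ∀ δ > 0, edist (G.loc i (p + t • w)) (y t) ≤ ENNReal.ofReal (2 * δ) := by
    intro δ hδ
    obtain ⟨t', ⟨h1, h2, h3⟩, htt'⟩ := Metric.mem_closure_iff.1 ht δ hδ
    have hd : edist (p + t • w) (p + t' • w) = ENNReal.ofReal |t - t'| := by
      rw [edist_dist, dist_add_left, dist_eq_norm, ← sub_smul, norm_smul, hw, mul_one,
        Real.norm_eq_abs]
    calc edist (G.loc i (p + t • w)) (y t)
        ≤ edist (G.loc i (p + t • w)) (y t') + edist (y t') (y t) := edist_triangle _ _ _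
      _ ≤ ENNReal.ofReal |t - t'| + ENNReal.ofReal |t - t'| := by
          refine add_le_add ?_ ?_
          · rw [← h3, ← hd]
            exact edist_loc_le hsq h1
          · rw [hy.edist_eq t' h2 t hIcc, abs_sub_comm]
      _ ≤ ENNReal.ofReal (2 * δ) := by
          rw [← ENNReal.ofReal_add (abs_nonneg _) (abs_nonneg _)]
          rw [Real.dist_eq] at htt'
          exact ENNReal.ofReal_le_ofReal (by linarith)
  by_contra hne
  have hfin := ne_top_of_le_ne_top ENNReal.ofReal_ne_top (hle 1 one_pos)
  have hpos := ENNReal.toReal_pos hne hfin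
  have h := hle _ (show 0 < (edist (G.loc i (p + t • w)) (y t)).toReal / 4 by positivity)
  rw [← ENNReal.ofReal_toReal hfin, ENNReal.ofReal_le_ofReal_iff (by positivity),
    ENNReal.toReal_ofReal ENNReal.toReal_nonneg] at h
  linarith

theorem IsVertexGeodesic.exists_isChord {q : Plane} {s : ℝ} (hq : Meets L y i q s)
    (hc : ∀ k, q ≠ corner k) :
    ∃ p w a b, IsChord L y i p w a b ∧ s ∈ Set.Icc a b ∧ p + s • w = q := by
  obtain ⟨F, w, ε, hε, hw, hF, -, hhalf, hy'⟩ := hy.exists_straight hq hc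
  set p : Plane := q - s • w with hp
  have hps : p + s • w = q := by simp [hp]
  have hpt : ∀ τ : ℝ, p + (s + τ) • w = q + τ • w := by
    intro τ
    rw [add_smul, ← add_assoc, hps]
  set K : Set ℝ := {t | p + t • w ∈ squareSet} with hK
  set M : Set ℝ := {t | Meets L y i (p + t • w) t} with hM
  have hMclosed : IsClosed M := hy.isClosed_meets p hw
  have hMK : M ⊆ K := fun t ht => ht.1
  have hw0 : w ≠ 0 := by
    rintro rfl
    simp at hw
  have hKconv : Convex ℝ K := by
    have : K = (AffineMap.lineMap p (p + w) : ℝ →ᵃ[ℝ] Plane) ⁻¹' squareSet := by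
      ext t
      simp [hK, AffineMap.lineMap_apply, add_comm]
    rw [this]
    exact convex_squareSet.affine_preimage _
  have hKclosed : IsClosed K := isClosed_squareSet.preimage (by fun_prop)
  have hnorm : ∀ t t' : ℝ, dist (p + t • w) (p + t' • w) = dist t t' := by
    intro t t'
    rw [dist_add_left, dist_eq_norm, ← sub_smul, norm_smul, hw, mul_one, Real.dist_eq,
      Real.norm_eq_abs]
  have hKb : Bornology.IsBounded K := by
    obtain ⟨C, hC⟩ := Metric.isBounded_iff.1 isBounded_squareSet
    exact Metric.isBounded_iff.2 ⟨C, fun t ht t' ht' => by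
      rw [← hnorm]
      exact hC ht ht'⟩
  have hMnear : ∀ τ, |τ| < ε → p + (s + τ) • w ∈ squareSet → s + τ ∈ M := by
    intro τ hτ hsq
    obtain ⟨h1, h2⟩ := hy' τ hτ
    refine ⟨hsq, h1, ?_⟩
    rw [← h2, ← hF _ hsq, hpt]
  have hsK : s ∈ K := by
    rw [hK, Set.mem_ofPred_eq, hps]
    exact hq.1
  obtain ⟨s₁, s₂, hs₁₂, hsub⟩ : ∃ s₁ s₂, s₁ < s₂ ∧ Set.Icc s₁ s₂ ⊆ M := by
    have habs : |ε / 2| < ε := by rw [abs_of_pos (by positivity)]; linarith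
    have hball : q + (ε / 2) • w ∈ Metric.ball q ε := by
      rw [Metric.mem_ball, dist_eq_norm, add_sub_cancel_left, norm_smul, hw, mul_one]
      exact habs
    rcases hhalf _ hball with h | h
    · refine ⟨s, s + ε / 2, by linarith, fun t ht => ?_⟩
      have htK : t ∈ K := hKconv.ordConnected.out hsK
        (show s + ε / 2 ∈ K by rw [hK, Set.mem_ofPred_eq, hpt]; exact h) ht
      have := hMnear (t - s) (by rw [abs_of_nonneg (by linarith [ht.1])]; linarith [ht.2])
        (by rwa [add_sub_cancel])
      rwa [add_sub_cancel] at this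
    · refine ⟨s + -(ε / 2), s, by linarith, fun t ht => ?_⟩
      have htK : t ∈ K := hKconv.ordConnected.out
        (show s + -(ε / 2) ∈ K by
          rw [hK, Set.mem_ofPred_eq, hpt]
          convert h using 1
          rw [two_smul, neg_smul]
          abel) hsK ht
      have := hMnear (t - s) (by rw [abs_of_nonpos (by linarith [ht.2])]; linarith [ht.1])
        (by rwa [add_sub_cancel])
      rwa [add_sub_cancel] at this
  have hKne : K.Nonempty := ⟨s, hsK⟩
  set a := sInf K
  set b := sSup K
  have haK : a ∈ K := hKclosed.csInf_mem hKne hKb.bddBelow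
  have hbK : b ∈ K := hKclosed.csSup_mem hKne hKb.bddAbove
  have hKab : ∀ t ∈ K, t ∈ Set.Icc a b := fun t ht =>
    ⟨csInf_le hKb.bddBelow ht, le_csSup hKb.bddAbove ht⟩
  have hKIcc : Set.Icc a b ⊆ K := hKconv.ordConnected.out haK hbK
  have has₁ : a ≤ s₁ := (hKab _ (hMK (hsub ⟨le_rfl, hs₁₂.le⟩))).1
  have hbs₂ : s₂ ≤ b := (hKab _ (hMK (hsub ⟨hs₁₂.le, le_rfl⟩))).2
  have hab : a < b := by linarith
  set U : Set ℝ := interior M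
  have hUsub : closure U ⊆ M := closure_minimal interior_subset hMclosed
  have hIoo : Set.Ioo a b ⊆ U := by
    refine isPreconnected_Ioo.subset_of_closure_inter_subset isOpen_interior ?_ ?_
    · refine ⟨(s₁ + s₂) / 2, ⟨by linarith, by linarith⟩, interior_mono hsub ?_⟩
      rw [interior_Icc]
      exact ⟨by linarith, by linarith⟩
    · rintro t ⟨htU, hta, htb⟩
      have htM := hUsub htU
      obtain ⟨F, v, ε, hε, hv, hF, hinj, -, hy'⟩ := hy.exists_straight htM
        (ne_corner_of_mem_Ioo hw0 ⟨hta, htb⟩ haK hbK)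
      obtain ⟨t', ht'U, htt'⟩ := Metric.mem_closure_iff.1 htU ε hε
      have hM' := interior_subset ht'U
      rw [dist_comm, Real.dist_eq] at htt'
      rcases eq_or_ne t' t with rfl | hne
      · exact ht'U
      have hvw : v = w := by
        have h1 := (hy' (t' - t) htt').2
        have e : p + t' • w = p + t • w + (t' - t) • w := by
          rw [add_assoc, ← add_smul, add_sub_cancel]
        rw [add_sub_cancel, ← hM'.2.2, ← hF _ hM'.1] at h1
        have hb : ∀ u : Plane, ‖u‖ = 1 → p + t • w + (t' - t) • u ∈ Metric.ball (p + t • w) ε := by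
          intro u hu
          rwa [Metric.mem_ball, dist_eq_norm, add_sub_cancel_left, norm_smul, hu, mul_one]
        have h2 := hinj (hb v hv) (e ▸ hb w hw) h1
        rw [e] at h2
        exact smul_right_injective Plane (sub_ne_zero.2 hne) (add_left_cancel h2)
      subst hvw
      refine mem_interior_iff_mem_nhds.2 ?_
      filter_upwards [Metric.ball_mem_nhds t hε, Ioo_mem_nhds hta htb] with x hx hx'
      have hxK : x ∈ K := hKIcc ⟨hx'.1.le, hx'.2.le⟩
      rw [Metric.mem_ball, Real.dist_eq] at hx
      obtain ⟨h1, h2⟩ := hy' (x - t) hx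
      rw [add_sub_cancel] at h1 h2
      refine ⟨hxK, h1, ?_⟩
      rw [← h2, ← hF _ hxK, add_assoc, ← add_smul, add_sub_cancel]
  refine ⟨p, w, a, b, ⟨hw, hab, fun t ht => ?_, fun t ht => hKab t ht⟩, hKab s hsK, hps⟩
  rw [← closure_Ioo hab.ne] at ht
  exact closure_minimal (hIoo.trans interior_subset) hMclosed ht

end SquareGluing

namespace SquareGluing
variable {ι : Type*} {G : SquareGluing ι}

theorem dist_add_smul {w : Plane} (hw : ‖w‖ = 1) (p : Plane) (s t : ℝ) :
    dist (p + s • w) (p + t • w) = |s - t| := by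
  rw [dist_add_left, dist_eq_norm, ← sub_smul, norm_smul, hw, mul_one, Real.norm_eq_abs]

theorem dist_lt_two {p q : Plane} (hp : p ∈ squareSet) (hq : q ∈ squareSet) : dist p q < 2 := by
  obtain ⟨⟨a, b⟩, c, d⟩ := mem_squareSet.1 hp
  obtain ⟨⟨a', b'⟩, c', d'⟩ := mem_squareSet.1 hq
  rw [plane_dist, Real.sqrt_lt' two_pos]
  nlinarith

theorem exists_mem_Icc_of_not_exit {x w : ℝ} (hx : x ∈ Set.Icc (0 : ℝ) 1)
    (h : ¬(x = 1 ∧ 0 < w ∨ x = 0 ∧ w < 0)) :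
    ∃ δ > 0, ∀ ε ∈ Set.Icc 0 δ, x + ε * w ∈ Set.Icc (0 : ℝ) 1 := by
  obtain ⟨h0, h1⟩ := hx
  rcases lt_trichotomy w 0 with hw | rfl | hw
  · have hx0 : 0 < x := lt_of_le_of_ne h0 fun h' => h (Or.inr ⟨h'.symm, hw⟩)
    refine ⟨x / -w, div_pos hx0 (neg_pos.2 hw), fun ε hε => ?_⟩
    have h2 := (le_div_iff₀ (neg_pos.2 hw)).1 hε.2
    have h3 := mul_nonpos_of_nonneg_of_nonpos hε.1 hw.le
    exact ⟨by linarith, by linarith⟩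
  · exact ⟨1, one_pos, fun ε _ => by simpa using ⟨h0, h1⟩⟩
  · have hx1 : x < 1 := lt_of_le_of_ne h1 fun h' => h (Or.inl ⟨h', hw⟩)
    refine ⟨(1 - x) / w, div_pos (sub_pos.2 hx1) hw, fun ε hε => ?_⟩
    have h2 := (le_div_iff₀ hw).1 hε.2
    have h3 := mul_nonneg hε.1 hw.le
    exact ⟨by linarith, by linarith⟩

/-- A ray that leaves the square at `x` does so through a side. -/
theorem exists_exit {x w : Plane} (hx : x ∈ squareSet) (h : ∀ δ > (0 : ℝ), x + δ • w ∉ squareSet) :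
    ∃ j, x j = 1 ∧ 0 < w j ∨ x j = 0 ∧ w j < 0 := by
  by_contra hne
  rw [not_exists] at hne
  obtain ⟨δ₀, h₀, H₀⟩ := exists_mem_Icc_of_not_exit (hx 0) (hne 0)
  obtain ⟨δ₁, h₁, H₁⟩ := exists_mem_Icc_of_not_exit (hx 1) (hne 1)
  have hδ := lt_min h₀ h₁
  refine h _ hδ (mem_squareSet.2 ⟨?_, ?_⟩)
  · simpa using H₀ _ ⟨hδ.le, min_le_left _ _⟩
  · simpa using H₁ _ ⟨hδ.le, min_le_right _ _⟩

theorem exists_corner {x y : ℝ} (hx : x = 0 ∨ x = 1) (hy : y = 0 ∨ y = 1) :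
    ∃ k, corner k 0 = x ∧ corner k 1 = y := by
  rcases hx with rfl | rfl <;> rcases hy with rfl | rfl
  · exact ⟨0, rfl, rfl⟩
  · exact ⟨3, rfl, rfl⟩
  · exact ⟨1, rfl, rfl⟩
  · exact ⟨2, rfl, rfl⟩

theorem exists_side {j : Fin 2} {v : ℝ} (hv : v = 0 ∨ v = 1) :
    ∃ k : Fin 4, segment ℝ (corner k) (corner (k + 1)) = {x | x ∈ squareSet ∧ x j = v} := by
  have key : ∀ (k : Fin 4) (S : Set Plane) (t : Plane → ℝ),
      (∀ s ∈ Set.Icc (0 : ℝ) 1, sidePoint k s ∈ S) →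
      (∀ x ∈ S, t x ∈ Set.Icc (0 : ℝ) 1 ∧ sidePoint k (t x) = x) →
      segment ℝ (corner k) (corner (k + 1)) = S := by
    intro k S t h1 h2
    rw [segment_eq_image_lineMap]
    refine Set.Subset.antisymm ?_ fun x hx => ⟨t x, (h2 x hx).1, (h2 x hx).2⟩
    rintro _ ⟨s, hs, rfl⟩
    exact h1 s hs
  have e : ∀ (k : Fin 4) (s : ℝ), sidePoint k s = turn k !₂[s, 0] := fun k s =>
    (turn_eq_sidePoint k (Q := !₂[s, 0]) rfl).symm
  fin_cases j <;> rcases hv with rfl | rfl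
  · refine ⟨3, key 3 _ (fun x => 1 - x 1) (fun s hs => ⟨sidePoint_mem hs, ?_⟩) fun x hx => ?_⟩
    · simp [e, turn]
    · obtain ⟨⟨-, h⟩, h'⟩ := And.imp_left mem_squareSet.1 hx
      refine ⟨⟨by linarith [h.2], by linarith [h.1]⟩, plane_ext ?_ ?_⟩
      · simpa [e, turn] using h'.symm
      · simp [e, turn]
  · refine ⟨1, key 1 _ (fun x => x 1) (fun s hs => ⟨sidePoint_mem hs, ?_⟩) fun x hx => ?_⟩
    · simp [e, turn]
    · obtain ⟨⟨-, h⟩, h'⟩ := And.imp_left mem_squareSet.1 hx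
      refine ⟨h, plane_ext ?_ ?_⟩
      · simpa [e, turn] using h'.symm
      · simp [e, turn]
  · refine ⟨0, key 0 _ (fun x => x 0) (fun s hs => ⟨sidePoint_mem hs, ?_⟩) fun x hx => ?_⟩
    · simp [e, turn]
    · obtain ⟨⟨h, -⟩, h'⟩ := And.imp_left mem_squareSet.1 hx
      refine ⟨h, plane_ext ?_ ?_⟩
      · simp [e, turn]
      · simpa [e, turn] using h'.symm
  · refine ⟨2, key 2 _ (fun x => 1 - x 0) (fun s hs => ⟨sidePoint_mem hs, ?_⟩) fun x hx => ?_⟩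
    · simp [e, turn]
    · obtain ⟨⟨h, -⟩, h'⟩ := And.imp_left mem_squareSet.1 hx
      refine ⟨⟨by linarith [h.2], by linarith [h.1]⟩, plane_ext ?_ ?_⟩
      · simp [e, turn]
      · simpa [e, turn] using h'.symm

theorem dist_lt_of_cut {A B c : Plane} (hc0 : A 0 = c 0) (hc1 : B 1 = c 1) (h0 : A 0 ≠ B 0)
    (h1 : A 1 ≠ B 1) : dist A c < dist A B ∧ dist B c < dist A B := by
  have p0 := pow_pos (abs_pos.2 (sub_ne_zero.2 h0)) 2
  have p1 := pow_pos (abs_pos.2 (sub_ne_zero.2 h1)) 2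
  rw [sq_abs] at p0 p1
  rw [plane_dist, plane_dist, plane_dist, ← hc0, ← hc1]
  constructor <;> apply Real.sqrt_lt_sqrt (by positivity) <;> nlinarith

/-- The intersection of a line with the square. -/
def lineTrace (p w : Plane) : Set Plane := {x | x ∈ squareSet ∧ ∃ s : ℝ, p + s • w = x}

/-- Between the times `a` and `b`, the line `s ↦ p + s • w` is in the open square. -/
def RunsInside (p w : Plane) (a b : ℝ) : Prop :=
  ∀ s ∈ Set.Ioo a b, ∀ j, (p + s • w) j ∈ Set.Ioo (0 : ℝ) 1

variable {L : ℝ} {y : ℝ → G.Surface} {i : ι} {p w : Plane} {a b : ℝ}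

theorem IsChord.lineTrace_eq (h : IsChord L y i p w a b) :
    lineTrace p w = segment ℝ (p + a • w) (p + b • w) := by
  have himg : segment ℝ (p + a • w) (p + b • w) = (fun s : ℝ => p + s • w) '' Set.Icc a b := by
    have := image_segment ℝ (AffineMap.lineMap p (p + w) : ℝ →ᵃ[ℝ] Plane) a b
    rw [segment_eq_Icc h.lt.le] at this
    have hline : ∀ s : ℝ, AffineMap.lineMap p (p + w) s = p + s • w := fun s => by
      simp [AffineMap.lineMap_apply, add_comm]
    simp only [hline] at this
    rw [← this]
  rw [himg]
  refine Set.Subset.antisymm ?_ ?_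
  · rintro _ ⟨hx, s, rfl⟩
    exact ⟨s, h.mem_Icc s hx, rfl⟩
  · rintro _ ⟨s, hs, rfl⟩
    exact ⟨(h.meets s hs).1, s, rfl⟩

theorem IsChord.exists_meets (h : IsChord L y i p w a b) {x : Plane} (hx : x ∈ lineTrace p w) :
    ∃ s, Meets L y i x s := by
  obtain ⟨hx, s, rfl⟩ := hx
  exact ⟨s, h.meets s (h.mem_Icc s hx)⟩

theorem IsChord.dist_eq (h : IsChord L y i p w a b) : dist (p + a • w) (p + b • w) = b - a := by
  rw [dist_add_smul h.norm_eq, abs_sub_comm, abs_of_pos (sub_pos.2 h.lt)]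

theorem IsChord.runsInside (h : IsChord L y i p w a b)
    (hj : ∀ j, w j ≠ 0 ∨ p j ∈ Set.Ioo (0 : ℝ) 1) : RunsInside p w a b := by
  intro s hs j
  have ha : p j + a * w j ∈ Set.Icc (0 : ℝ) 1 := by
    simpa using (h.meets a (Set.left_mem_Icc.2 h.lt.le)).1 j
  have hb : p j + b * w j ∈ Set.Icc (0 : ℝ) 1 := by
    simpa using (h.meets b (Set.right_mem_Icc.2 h.lt.le)).1 j
  have goal : (p + s • w) j = p j + s * w j := by simp
  rw [goal]
  rcases lt_trichotomy (w j) 0 with hw | hw | hw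
  · have h1 := mul_neg_of_pos_of_neg (sub_pos.2 hs.1) hw
    have h2 := mul_neg_of_pos_of_neg (sub_pos.2 hs.2) hw
    exact ⟨by linarith [hb.1], by linarith [ha.2]⟩
  · have := (hj j).resolve_left (not_not.2 hw)
    simpa [hw] using this
  · have h1 := mul_pos (sub_pos.2 hs.1) hw
    have h2 := mul_pos (sub_pos.2 hs.2) hw
    exact ⟨by linarith [ha.1], by linarith [hb.2]⟩

/-- A chord through the open square one corner of which is near to both ends. -/
def Cuts (k : Fin 4) (p w : Plane) (a b : ℝ) : Prop :=
  RunsInside p w a b ∧ dist (p + a • w) (corner k) < b - a ∧ dist (p + b • w) (corner k) < b - a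

theorem IsChord.cuts_or_long_or_side (h : IsChord L y i p w a b) :
    (∃ k, Cuts k p w a b) ∨ (RunsInside p w a b ∧ 1 ≤ b - a) ∨
      ∃ k : Fin 4, lineTrace p w = segment ℝ (corner k) (corner (k + 1)) := by
  have hA := (h.meets a (Set.left_mem_Icc.2 h.lt.le)).1
  have hB := (h.meets b (Set.right_mem_Icc.2 h.lt.le)).1
  have hAj : ∀ j, (p + a • w) j = p j + a * w j := fun j => by simp
  have hBj : ∀ j, (p + b • w) j = p j + b * w j := fun j => by simp
  obtain ⟨jB, hjB⟩ := exists_exit (w := w) hB fun δ hδ hmem => by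
    rw [add_assoc, ← add_smul] at hmem
    linarith [(h.mem_Icc _ hmem).2]
  obtain ⟨jA, hjA⟩ := exists_exit (w := -w) hA fun δ hδ hmem => by
    rw [smul_neg, ← neg_smul, add_assoc, ← add_smul] at hmem
    linarith [(h.mem_Icc _ hmem).1]
  simp only [PiLp.neg_apply, Left.neg_pos_iff, Left.neg_neg_iff] at hjA
  have hwA : w jA ≠ 0 := by
    rcases hjA with h | h
    · exact h.2.ne
    · exact h.2.ne'
  have hwB : w jB ≠ 0 := by
    rcases hjB with h | h
    · exact h.2.ne'
    · exact h.2.ne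
  have hvA : (p + a • w) jA = 0 ∨ (p + a • w) jA = 1 := hjA.symm.imp And.left And.left
  have hvB : (p + b • w) jB = 0 ∨ (p + b • w) jB = 1 := hjB.symm.imp And.left And.left
  have hne : ∀ j, w j ≠ 0 → (p + a • w) j ≠ (p + b • w) j := by
    intro j hj heq
    rw [hAj, hBj] at heq
    have : (b - a) * w j = 0 := by linarith
    exact (mul_ne_zero (sub_pos.2 h.lt).ne' hj) this
  rcases eq_or_ne jA jB with rfl | hAB
  · right
    have hlong : 1 ≤ b - a := by
      have hw1 := PiLp.norm_apply_le (p := 2) w jA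
      rw [h.norm_eq, Real.norm_eq_abs, abs_le] at hw1
      have hab := sub_pos.2 h.lt
      rw [hBj] at hjB
      rw [hAj] at hjA
      rcases hjA with ⟨h1, h2⟩ | ⟨h1, h2⟩ <;> rcases hjB with ⟨h3, h4⟩ | ⟨h3, h4⟩
      · linarith
      · nlinarith
      · nlinarith
      · linarith
    by_cases hin : ∀ j, w j ≠ 0 ∨ p j ∈ Set.Ioo (0 : ℝ) 1
    · exact Or.inl ⟨h.runsInside hin, hlong⟩
    right
    push Not at hin
    obtain ⟨j, hj, hpj⟩ := hin
    have hjA : jA ≠ j := by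
      rintro rfl
      exact hwA hj
    have hpj' : p j = 0 ∨ p j = 1 := by
      have := hA j
      rw [hAj, hj, mul_zero, add_zero] at this
      rcases this.1.eq_or_lt with h0 | h0
      · exact Or.inl h0.symm
      · rcases this.2.eq_or_lt with h1 | h1
        · exact Or.inr h1
        · exact absurd ⟨h0, h1⟩ hpj
    obtain ⟨k, hk⟩ := exists_side (j := j) hpj'
    refine ⟨k, ?_⟩
    rw [hk]
    ext x
    constructor
    · rintro ⟨hx, s, rfl⟩
      refine ⟨hx, ?_⟩
      simp [hj]
    · rintro ⟨hx, hxj⟩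
      refine ⟨hx, (x jA - p jA) / w jA, ?_⟩
      ext l
      rcases eq_or_ne l j with rfl | hl
      · simp [hj, hxj]
      · obtain rfl : l = jA := by omega
        simp [div_mul_cancel₀ _ hwA]
  · left
    have hboth : RunsInside p w a b := h.runsInside fun j => Or.inl (by
      have : j = jA ∨ j = jB := by omega
      rcases this with rfl | rfl
      · exact hwA
      · exact hwB)
    rcases (show jA = 0 ∧ jB = 1 ∨ jA = 1 ∧ jB = 0 by omega) with ⟨rfl, rfl⟩ | ⟨rfl, rfl⟩
    · obtain ⟨k, h0, h1⟩ := exists_corner hvA hvB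
      refine ⟨k, hboth, ?_⟩
      rw [← h.dist_eq]
      exact dist_lt_of_cut h0.symm h1.symm (hne 0 hwA) (hne 1 hwB)
    · obtain ⟨k, h0, h1⟩ := exists_corner hvB hvA
      refine ⟨k, hboth, ?_⟩
      rw [← h.dist_eq, dist_comm (p + a • w) (p + b • w)]
      exact (dist_lt_of_cut h0.symm h1.symm (hne 0 hwB).symm (hne 1 hwA).symm).symm

theorem Meets.eq {x x' : Plane} {s : ℝ} (hx : Meets L y i x s) (hx' : Meets L y i x' s)
    (hin : ∀ j, x j ∈ Set.Ioo (0 : ℝ) 1) : x = x' :=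
  eq_of_loc_eq (hin 0) (hin 1) hx'.1 (hx.2.2.trans hx'.2.2.symm)

theorem IsChord.eq_of_overlap {p' w' : Plane} {a' b' : ℝ} (h : IsChord L y i p w a b)
    (h' : IsChord L y i p' w' a' b') (hin : RunsInside p w a b) (hab' : a < b') (ha'b : a' < b) :
    p = p' ∧ w = w' := by
  have hlt : max a a' < min b b' :=
    max_lt (lt_min h.lt hab') (lt_min ha'b h'.lt)
  obtain ⟨s, hs1, hs2⟩ := exists_between hlt
  obtain ⟨t, ht1, ht2⟩ := exists_between hs2
  have key : ∀ r, max a a' < r → r < min b b' → p + r • w = p' + r • w' := by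
    intro r h1 h2
    rw [max_lt_iff] at h1
    rw [lt_min_iff] at h2
    exact Meets.eq (h.meets r ⟨h1.1.le, h2.1.le⟩) (h'.meets r ⟨h1.2.le, h2.2.le⟩)
      (hin r ⟨h1.1, h2.1⟩)
  have es := key s hs1 hs2
  have et := key t (hs1.trans ht1) ht2
  have hw : w = w' := by
    have : (t - s) • w = (t - s) • w' := by
      rw [sub_smul, sub_smul]
      calc t • w - s • w = (p + t • w) - (p + s • w) := by abel
        _ = t • w' - s • w' := by rw [es, et]; abel
    exact smul_right_injective Plane (sub_pos.2 ht1).ne' this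
  subst hw
  exact ⟨add_right_cancel es, rfl⟩

section
variable (hy : G.IsVertexGeodesic L y)
include hy

theorem IsVertexGeodesic.sub_le_dist {p' w' : Plane} {a' b' : ℝ} (h : IsChord L y i p w a b)
    (h' : IsChord L y i p' w' a' b') : b' - a ≤ dist (p + a • w) (p' + b' • w') := by
  have := hy.abs_sub_le_dist (h.meets a (Set.left_mem_Icc.2 h.lt.le))
    (h'.meets b' (Set.right_mem_Icc.2 h'.lt.le))
  rw [abs_sub_comm] at this
  exact (le_abs_self _).trans this

theorem IsVertexGeodesic.cuts_unique {k : Fin 4} {p' w' : Plane} {a' b' : ℝ}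
    (h : IsChord L y i p w a b) (h' : IsChord L y i p' w' a' b') (hk : Cuts k p w a b)
    (hk' : Cuts k p' w' a' b') : p = p' ∧ w = w' := by
  refine h.eq_of_overlap h' hk.1 ?_ ?_ <;> by_contra! hle
  · have h1 := hy.sub_le_dist h' h
    have h2 := dist_triangle_right (p' + a' • w') (p + b • w) (corner k)
    linarith [hk.2.2, hk'.2.1]
  · have h1 := hy.sub_le_dist h h'
    have h2 := dist_triangle_right (p + a • w) (p' + b' • w') (corner k)
    linarith [hk.2.1, hk'.2.2]

theorem IsVertexGeodesic.long_unique {p' w' : Plane} {a' b' : ℝ} (h : IsChord L y i p w a b)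
    (h' : IsChord L y i p' w' a' b') (hin : RunsInside p w a b) (hl : 1 ≤ b - a)
    (hl' : 1 ≤ b' - a') : p = p' ∧ w = w' := by
  have hd : ∀ {p w p' w' : Plane} {a b a' b' : ℝ}, IsChord L y i p w a b →
      IsChord L y i p' w' a' b' → b' - a < 2 := fun h h' =>
    (hy.sub_le_dist h h').trans_lt (dist_lt_two (h.meets _ (Set.left_mem_Icc.2 h.lt.le)).1
      (h'.meets _ (Set.right_mem_Icc.2 h'.lt.le)).1)
  refine h.eq_of_overlap h' hin ?_ ?_ <;> by_contra! hle
  · linarith [hd h' h]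
  · linarith [hd h h']

theorem IsVertexGeodesic.not_meets_corner {k : Fin 4} (h : IsChord L y i p w a b)
    (hk : Cuts k p w a b) (t : ℝ) : ¬ Meets L y i (corner k) t := by
  intro ht
  have h1 := hy.abs_sub_le_dist (h.meets a (Set.left_mem_Icc.2 h.lt.le)) ht
  have h2 := hy.abs_sub_le_dist (h.meets b (Set.right_mem_Icc.2 h.lt.le)) ht
  obtain ⟨hin, hka, hkb⟩ := hk
  have h3 := abs_lt.1 (h1.trans_lt hka)
  have h4 := abs_lt.1 (h2.trans_lt hkb)
  have hs : t ∈ Set.Ioo a b := ⟨by linarith, by linarith⟩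
  have e := Meets.eq (h.meets t ⟨hs.1.le, hs.2.le⟩) ht (hin t hs)
  have := hin t hs 0
  rw [e] at this
  have hc : corner k 0 = 0 ∨ corner k 0 = 1 := by fin_cases k <;> simp [corner]
  rcases hc with hc | hc <;> rw [hc] at this
  · exact this.1.false
  · exact this.2.false

end

theorem exists_segments_of_iUnion {κ : Type*} [Fintype κ] (f : κ → Set Plane)
    (hf : ∀ k, f k = ∅ ∨ ∃ a b, f k = segment ℝ a b) :
    ∃ (m : ℕ) (a b : Fin m → Plane), m ≤ Fintype.card κ ∧ ⋃ k, f k = ⋃ j, segment ℝ (a j) (b j) := by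
  by_cases h : ∀ k, f k = ∅
  · exact ⟨0, Fin.elim0, Fin.elim0, Nat.zero_le _, by simp [h]⟩
  push Not at h
  obtain ⟨k₀, hk₀⟩ := h
  obtain ⟨a₀, b₀, h₀⟩ := (hf k₀).resolve_left hk₀.ne_empty
  have hex : ∀ k, ∃ a b, f k ⊆ segment ℝ a b ∧ segment ℝ a b ⊆ ⋃ k, f k := by
    intro k
    rcases hf k with h | ⟨a, b, h⟩
    · exact ⟨a₀, b₀, by simp [h], h₀ ▸ Set.subset_iUnion f k₀⟩
    · exact ⟨a, b, h.le, h ▸ Set.subset_iUnion f k⟩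
  choose a b hab hba using hex
  let e := Fintype.equivFin κ
  refine ⟨Fintype.card κ, a ∘ e.symm, b ∘ e.symm, le_rfl, Set.Subset.antisymm ?_ ?_⟩
  · refine Set.iUnion_subset fun k => (hab k).trans ?_
    have := Set.subset_iUnion (fun j => segment ℝ ((a ∘ e.symm) j) ((b ∘ e.symm) j)) (e k)
    simpa using this
  · exact Set.iUnion_subset fun j => hba _

theorem IsVertexGeodesic.exists_segments (hy : G.IsVertexGeodesic L y) (i : ι) :
    ∃ (m : ℕ) (a b : Fin m → Plane), m ≤ 5 ∧
      {x | ∃ s, Meets L y i x s} = ⋃ j, segment ℝ (a j) (b j) := by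
  classical
  set X : Set Plane := {x | ∃ s, Meets L y i x s}
  set side : Fin 4 → Set Plane := fun k => segment ℝ (corner k) (corner (k + 1)) with hside
  set cut : Fin 4 → Set Plane := fun k =>
    {x | ∃ p w a b, IsChord L y i p w a b ∧ Cuts k p w a b ∧ x ∈ lineTrace p w}
  set long : Set Plane := {x | ∃ p w a b, IsChord L y i p w a b ∧ RunsInside p w a b ∧
    1 ≤ b - a ∧ x ∈ lineTrace p w}
  let f : Option (Fin 4) → Set Plane := fun o =>
    o.elim long fun k => if side k ⊆ X then side k else cut k ∪ ({corner k} ∩ X)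
  have hseg : ∀ o, f o = ∅ ∨ ∃ a b, f o = segment ℝ a b := by
    rintro (_ | k)
    · rcases Set.eq_empty_or_nonempty long with h | ⟨x, p, w, a, b, h, hin, hl, -⟩
      · exact Or.inl h
      · refine Or.inr ⟨_, _, Eq.trans ?_ h.lineTrace_eq⟩
        refine Set.Subset.antisymm ?_ fun x hx => ⟨p, w, a, b, h, hin, hl, hx⟩
        rintro x ⟨p', w', a', b', h', hin', hl', hx⟩
        obtain ⟨rfl, rfl⟩ := hy.long_unique h h' hin hl hl'
        exact hx
    · by_cases hs : side k ⊆ X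
      · exact Or.inr ⟨_, _, if_pos hs⟩
      have hfk : f (some k) = cut k ∪ ({corner k} ∩ X) := if_neg hs
      rw [hfk]
      rcases Set.eq_empty_or_nonempty (cut k) with h | ⟨x, p, w, a, b, h, hk, -⟩
      · rw [h, Set.empty_union]
        by_cases hc : corner k ∈ X
        · refine Or.inr ⟨corner k, corner k, ?_⟩
          rw [segment_same, Set.inter_eq_left]
          simpa using hc
        · exact Or.inl (Set.singleton_inter_eq_empty.2 hc)
      · refine Or.inr ⟨_, _, Eq.trans ?_ h.lineTrace_eq⟩
        refine Set.Subset.antisymm ?_ fun x hx => Or.inl ⟨p, w, a, b, h, hk, hx⟩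
        rintro x (⟨p', w', a', b', h', hk', hx⟩ | ⟨rfl, t, ht⟩)
        · obtain ⟨rfl, rfl⟩ := hy.cuts_unique h h' hk hk'
          exact hx
        · exact absurd ht (hy.not_meets_corner h hk t)
  have hXf : X = ⋃ o, f o := by
    refine Set.Subset.antisymm ?_ (Set.iUnion_subset ?_)
    · rintro x ⟨s, hx⟩
      rw [Set.mem_iUnion]
      by_cases hc : ∀ k, x ≠ corner k
      · obtain ⟨p, w, a, b, h, -, hpx⟩ := hy.exists_isChord hx hc
        have hxt : x ∈ lineTrace p w := ⟨hx.1, s, hpx⟩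
        rcases h.cuts_or_long_or_side with ⟨k, hk⟩ | ⟨hin, hl⟩ | ⟨k, hk⟩
        · refine ⟨some k, ?_⟩
          have hs : ¬ side k ⊆ X := fun hs => by
            obtain ⟨t, ht⟩ := hs (left_mem_segment ℝ _ _)
            exact hy.not_meets_corner h hk t ht
          have hfk : f (some k) = cut k ∪ ({corner k} ∩ X) := if_neg hs
          rw [hfk]
          exact Or.inl ⟨p, w, a, b, h, hk, hxt⟩
        · exact ⟨none, p, w, a, b, h, hin, hl, hxt⟩
        · refine ⟨some k, ?_⟩
          have hs : side k ⊆ X := by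
            simp only [hside, ← hk]
            exact fun x hx => h.exists_meets hx
          have hfk : f (some k) = side k := if_pos hs
          simp only [hfk, hside, ← hk]
          exact hxt
      · push Not at hc
        obtain ⟨k, rfl⟩ := hc
        refine ⟨some k, ?_⟩
        show corner k ∈ ite _ _ _
        split_ifs with hs
        · exact left_mem_segment ℝ _ _
        · exact Or.inr ⟨rfl, s, hx⟩
    · rintro (_ | k)
      · rintro x ⟨p, w, a, b, h, -, -, hx⟩
        exact h.exists_meets hx
      · show ite _ _ _ ⊆ X
        split_ifs with hs
        · exact hs
        · rintro x (⟨p, w, a, b, h, -, hx⟩ | hx)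
          · exact h.exists_meets hx
          · exact hx.2
  obtain ⟨m, a, b, hm, h⟩ := exists_segments_of_iUnion f hseg
  exact ⟨m, a, b, by simpa using hm, hXf.trans h⟩

end SquareGluing

theorem theorem1 {ι : Type*} [Finite ι] (G : SquareGluing ι) (u v : G.Surface)
    (hu : G.IsVertex u) (hv : G.IsVertex v) (π : Path u v)
    (hπ : SquareGluing.IsShortestPath π) (i : ι) :
    ∃ (m : ℕ) (a b : Fin m → Plane), m ≤ 5 ∧
      SquareGluing.inSquare π i = ⋃ j, segment ℝ (a j) (b j) := by
  obtain ⟨L, y, hy, hrange⟩ := hπ.exists_isVertexGeodesic hu hv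
  obtain ⟨m, a, b, hm, h⟩ := hy.exists_segments i
  refine ⟨m, a, b, hm, h ▸ ?_⟩
  ext x
  constructor
  · rintro ⟨p, rfl, hp⟩
    rw [hrange] at hp
    obtain ⟨s, hs, hps⟩ := hp
    exact ⟨s, p.2, hs, by rw [← SquareGluing.pt_eq_loc, hps]⟩
  · rintro ⟨s, hx, hs, h⟩
    exact ⟨⟨x, hx⟩, rfl, hrange ▸ ⟨s, hs, by rw [SquareGluing.pt_eq_loc, h]⟩⟩
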